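/- **Proposition 4.3.** Let $\mathbb{H}^2=\{z\in\mathbb{C}:\operatorname{Im}z>0\}$, and let $\mathbb{H}^3$ be hyperbolic three-space of curvature $-1$, with boundary $\partial\mathbb{H}^3=\mathbb{P}^1$ and with the isometric action of $PGL_2(\mathbb{C})$ that extends the action on $\mathbb{P}^1$ by Möbius transformations. For $x\in\mathbb{H}^3$ let $\nu_x$ be the visual metric on $\mathbb{P}^1$ from $x$: the round metric of the unit tangent sphere at $x$, transported to $\mathbb{P}^1$ by sending a unit vector to the endpoint of its geodesic ray. For a $C^1$ conformal metric $\lambda=\rho(z)|dz|^2$ ($\rho>0$) on $\mathbb{H}^2$ and a locally injective holomorphic map $\mathrm{Dev}:\mathbb{H}^2\to\mathbb{P}^1$, *Epstein's surface* $\mathrm{Ep}_{(\lambda,\mathrm{Dev})}:\mathbb{H}^2\to\mathbb{H}^3$ is the continuous map such that for every $z$ the metrics $\mathrm{Dev}^*\nu_{\mathrm{Ep}_{(\lambda,\mathrm{Dev})}(z)}$ and $\lambda$ have the same $1$-jet at $z$. Fix such a $\lambda$ and two locally injective holomorphic maps $\mathrm{Dev}^1,\mathrm{Dev}^2:\mathbb{H}^2\to\mathbb{P}^1$.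 Then: 1. There is a unique map $\mathrm{Osc}:\mathbb{H}^2\to PGL_2(\mathbb{C})$ such that for every $z$ the $2$-jets at $z$ of $\mathrm{Osc}(z)\circ\mathrm{Dev}^2$ and of $\mathrm{Dev}^1$ coincide. For $i=1,2$ there is a unique map $\mathrm{Ep}_{(\lambda,\mathrm{Dev}^i)}$ as above. 2. For every $z\in\mathbb{H}^2$, $$\mathrm{Osc}(z)\cdot \mathrm{Ep}_{(\lambda,\mathrm{Dev}^2)}(z)=\mathrm{Ep}_{(\lambda,\mathrm{Dev}^1)}(z).$$ 3. For $G=PGL_2(\mathbb{C})$ and every locally injective holomorphic $\mathrm{Dev}:\mathbb{H}^2\to\mathbb{P}^1$, the Epstein–Poincaré surface of the oper with developing map $\mathrm{Dev}$ is Epstein's surface $\mathrm{Ep}_{(\lambda_{-1},\mathrm{Dev})}$ of the hyperbolic metric $\lambda_{-1}=|dz|^2/(\operatorname{Im}z)^2$ of curvature $-1$: a map $\mathbb{H}^2\to\mathbb{H}^3$ is the former if and only if it is the latter. Here the Epstein–Poincaré surface of $\mathrm{Dev}$ is $z\mapsto O(z)\cdot\mathrm{Ep}^0(z)$, with $O$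 and $\mathrm{Ep}^0$ as follows. Put $e=\tfrac1{\sqrt2}E_{12}$, $h=\operatorname{diag}(\tfrac12,-\tfrac12)$, $f=\tfrac1{\sqrt2}E_{21}$. * The canonical lift of a locally injective holomorphic $F:\mathbb{H}^2\to\mathbb{P}^1$ is the map $\overline F:\mathbb{H}^2\to PGL_2(\mathbb{C})$ with $\overline F(z)\cdot[1:0]=F(z)$ that is locally represented by holomorphic matrix functions $M$ with $M^{-1}M'=f+\alpha e$ for a function $\alpha$. Then $O(z)=\overline{\mathrm{Dev}}(z)\,\overline{\mathrm{Dev}_F}(z)^{-1}$, where $\mathrm{Dev}_F(z)=[z:1]$ is the inclusion $\mathbb{H}^2\subset\mathbb{P}^1$. * Identify $\mathbb{H}^3$ with the space of Cartan involutions of $\mathfrak{sl}_2(\mathbb{C})$. Put $H=\tfrac1{2(\operatorname{Im}z)^2}$, so that $H\,dz\,d\bar z$ is the hyperbolic metric of curvature $-2$. On $\mathbb{H}^2\times\mathfrak{sl}_2(\mathbb{C})$ take the flat connection $D=d+\operatorname{ad}\omega$ with $\omega=(f-\partial_z(\log H)\,h)\,dz+H\,e\,d\bar z$, and the fibrewise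 Cartan involution given by the antilinear maps $\Theta^0_z$ with $\Theta^0_z e=-H^{-1}f$, $\Theta^0_z h=-h$, $\Theta^0_z f=-H e$. Then $\mathrm{Ep}^0(z)=\operatorname{Ad}(M(z))\circ\Theta^0_z\circ\operatorname{Ad}(M(z))^{-1}$, for $M:\mathbb{H}^2\to GL_2(\mathbb{C})$ with $M^{-1}dM=\omega$ and $M(z)\cdot[1:0]=[z:1]$ for all $z$. -/

import Mathlib

open scoped MatrixGroups LinearAlgebra.Projectivization UpperHalfPlane Topology Matrix ComplexOrder
open Matrix UpperHalfPlane

noncomputable section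

namespace EP

/-! ### The projective line and holomorphic maps into it -/

/-- The complex projective line `ℙ¹ = ℙ(ℂ²)`. Mathlib provides the action of `PGL(2, ℂ)` on it. -/
abbrev ProjLine : Type := ℙ ℂ (Fin 2 → ℂ)

/-- The domain of the `i`-th standard affine chart of `ℙ¹`: the points `[v₀ : v₁]` with `vᵢ ≠ 0`. -/
def InChart (i : Fin 2) (ξ : ProjLine) : Prop := ξ.rep i ≠ 0

/-- The `i`-th standard affine coordinate `[v₀ : v₁] ↦ v₁₋ᵢ / vᵢ` of `ℙ¹`, meaningful on the domain
of the `i`-th chart. -/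
def coord (i : Fin 2) (ξ : ProjLine) : ℂ := ξ.rep (1 - i) / ξ.rep i

/-- A map `ℍ → ℙ¹` is holomorphic: near every point it takes values in one of the standard charts
and is complex differentiable in the coordinate of this chart. -/
def Holomorphic (F : ℍ → ProjLine) : Prop :=
  ∀ z : ℍ, ∃ i : Fin 2, ∀ᶠ w : ℂ in 𝓝 (z : ℂ),
    InChart i (F (ofComplex w)) ∧ DifferentiableAt ℂ (fun u : ℂ => coord i (F (ofComplex u))) w

/-- Local injectivity: every point has a neighbourhood on which `F` is injective. -/
def LocallyInjective (F : ℍ → ProjLine) : Prop :=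
  ∀ z : ℍ, ∃ U ∈ 𝓝 z, Set.InjOn F U

/-- The `2`-jets at `z` of two maps `F, G : ℍ → ℙ¹` coincide: the values at `z` are equal, and in
each standard chart around this value the derivatives of order at most two at `z` are equal. -/
def TwoJetEq (F G : ℍ → ProjLine) (z : ℍ) : Prop :=
  F z = G z ∧ ∀ i : Fin 2, InChart i (F z) → ∀ k : ℕ, k ≤ 2 →
    iteratedDeriv k (fun w : ℂ => coord i (F (ofComplex w))) (z : ℂ) =
      iteratedDeriv k (fun w : ℂ => coord i (G (ofComplex w))) (z : ℂ)

/-- `g ∈ PGL(2, ℂ)` is an osculating Möbius transformation from `F₂` to `F₁` at `z`: the maps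
`g ∘ F₂` and `F₁` have the same `2`-jet at `z`. -/
def Osculates (g : PGL(2, ℂ)) (F₂ F₁ : ℍ → ProjLine) (z : ℍ) : Prop :=
  TwoJetEq (fun w => g • F₂ w) F₁ z

/-! ### Hyperbolic three-space

We use the hyperboloid model: the Hermitian `2 × 2` matrices form a Minkowski space of signature
`(1, 3)` for the quadratic form `det`, and `ℍ³` is the sheet of positive definite matrices of
determinant one. Its Riemannian metric (of curvature `-1`) is the restriction of `-det`. The boundary
at infinity is the projectivized light cone, identified with `ℙ¹` through `[v] ↦ ℝ>0 · v vᴴ`. In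
upper half-space coordinates, `(a, t)` with `a ∈ ℂ`, `t > 0` is the matrix with rows
`(|a|² + t², a) / t` and `(conj a, 1) / t`. -/

/-- Hyperbolic three-space: positive definite Hermitian matrices of determinant one. -/
@[ext]
structure HypThree where
  /-- the underlying matrix -/
  mat : Matrix (Fin 2) (Fin 2) ℂ
  posDef : mat.PosDef
  det_eq : mat.det = 1

/-- The topology of `ℍ³` is the one of the space of matrices. -/
instance : TopologicalSpace HypThree := TopologicalSpace.induced HypThree.mat inferInstance

/-- The action of `GL(2, ℂ)` on `ℍ³` by isometries: `g • A = |det g|⁻¹ g A gᴴ`. -/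
instance : SMul (GL (Fin 2) ℂ) HypThree where
  smul g A :=
    { mat := ((‖g.val.det‖⁻¹ : ℝ) : ℂ) • (g.val * A.mat * g.valᴴ)
      posDef := by
        have hg : g.val.det ≠ 0 := g.det.ne_zero
        have hpos : (0 : ℝ) < ‖g.val.det‖⁻¹ := by positivity
        refine Matrix.PosDef.smul ?_ (by exact_mod_cast hpos)
        refine A.posDef.mul_mul_conjTranspose_same ?_
        exact Matrix.vecMul_injective_of_isUnit g.isUnit
      det_eq := by
        have hg : g.val.det ≠ 0 := g.det.ne_zero
        rw [Matrix.det_smul, Matrix.det_mul, Matrix.det_mul, A.det_eq, Matrix.det_conjTranspose]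
        have h : g.val.det * star g.val.det = ((‖g.val.det‖ ^ 2 : ℝ) : ℂ) := by
          rw [← Complex.normSq_eq_norm_sq]; exact Complex.mul_conj _
        rw [mul_one, h, Fintype.card_fin]
        have h2 : ‖g.val.det‖ ≠ 0 := norm_ne_zero_iff.mpr hg
        norm_cast
        field_simp }

theorem smul_mat (g : GL (Fin 2) ℂ) (A : HypThree) :
    (g • A).mat = ((‖g.val.det‖⁻¹ : ℝ) : ℂ) • (g.val * A.mat * g.valᴴ) := rfl

instance : MulAction (GL (Fin 2) ℂ) HypThree where
  one_smul A := HypThree.ext (by rw [smul_mat]; simp)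
  mul_smul g h A := HypThree.ext (by
    rw [smul_mat, smul_mat, smul_mat]
    simp [Matrix.conjTranspose_mul, Matrix.mul_assoc, smul_smul, mul_comm])

/-- The induced action of `PGL(2, ℂ)` on `ℍ³`. -/
instance : MulAction PGL(2, ℂ) HypThree :=
  Matrix.ProjGenLinGroup.mulActionOfGL fun u A => HypThree.ext (by
    rw [smul_mat]
    have hu : (u : ℂ) ≠ 0 := u.ne_zero
    have h1 : ((GeneralLinearGroup.scalar (Fin 2) u : GL (Fin 2) ℂ) : Matrix (Fin 2) (Fin 2) ℂ)
        = (u : ℂ) • (1 : Matrix (Fin 2) (Fin 2) ℂ) := by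
      ext i j; simp [Matrix.one_apply, Matrix.diagonal_apply]
    have h2 : ((‖(u : ℂ)‖ ^ 2 : ℝ) : ℂ) = star (u : ℂ) * (u : ℂ) := by
      rw [← Complex.normSq_eq_norm_sq, mul_comm]; exact (Complex.mul_conj _).symm
    have h3 : ‖(u : ℂ)‖ ≠ 0 := norm_ne_zero_iff.mpr hu
    rw [h1]
    simp only [Matrix.det_smul, Matrix.det_one, mul_one, Fintype.card_fin, norm_pow,
      Matrix.conjTranspose_smul, Matrix.conjTranspose_one, Matrix.smul_mul, Matrix.mul_smul,
      Matrix.one_mul, smul_smul]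
    rw [← h2, ← Complex.ofReal_mul, inv_mul_cancel₀ (pow_ne_zero 2 h3), Complex.ofReal_one,
      one_smul])

theorem mk_smul_hypThree (g : GL (Fin 2) ℂ) (A : HypThree) :
    (Matrix.ProjGenLinGroup.mk g : PGL(2, ℂ)) • A = g • A := rfl

/-! ### Visual metrics and Epstein surfaces -/

/-- The unit tangent vector at `A ∈ ℍ³` pointing to the boundary point `ξ = [v] ∈ ℙ¹`: the vector
`c v vᴴ - A` with `c = 2 / (vᴴ A⁻¹ v)`, which does not depend on the choice of `v`. (It is orthogonal
to `A`, it has length one, and the geodesic `cosh s A + sinh s Y` that it spans tends to `[v vᴴ]`.) -/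
def unitToward (A : HypThree) (ξ : ProjLine) : Matrix (Fin 2) (Fin 2) ℂ :=
  (2 / (star ξ.rep ⬝ᵥ (A.mat⁻¹ *ᵥ ξ.rep))) • vecMulVec ξ.rep (star ξ.rep) - A.mat

/-- The pull-back `F^* ν_A` of the visual metric `ν_A` under `F : ℍ → ℙ¹`, at the point `w` on the
tangent vector `v`. The visual metric `ν_A` on `ℙ¹` is the round metric of the unit tangent sphere
at `A`, transported by `ξ ↦ unitToward A ξ`; so `F^* ν_A (v, v)` is the squared length `-det Y` in
`T_A ℍ³` of the derivative `Y` of `unitToward A ∘ F` in the direction `v`. -/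
def visualPullback (A : HypThree) (F : ℍ → ProjLine) (w v : ℂ) : ℝ :=
  -(Matrix.det (Matrix.of fun i j : Fin 2 =>
      fderiv ℝ (fun u : ℂ => unitToward A (F (ofComplex u)) i j) w v)).re

/-- A conformal metric `ρ(z) |dz|²` of class `C¹` on the upper half-plane. -/
structure ConformalMetric where
  /-- the density `ρ` -/
  density : ℍ → ℝ
  density_pos : ∀ z, 0 < density z
  contDiffOn : ContDiffOn ℝ 1 (fun w : ℂ => density (ofComplex w)) {w : ℂ | 0 < w.im}

/-- The `1`-jets at `z` of the metrics `F^* ν_A` and `ρ |dw|²` coincide: for every constant vector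
field `v`, the functions `w ↦ F^* ν_A (v, v)` and `w ↦ ρ(w) |v|²` have the same value and the same
differential at `z`. -/
def OneJetEq (A : HypThree) (F : ℍ → ProjLine) (ρ : ConformalMetric) (z : ℍ) : Prop :=
  ∀ v : ℂ,
    visualPullback A F (z : ℂ) v = ρ.density z * ‖v‖ ^ 2 ∧
    fderiv ℝ (fun w : ℂ => visualPullback A F w v) (z : ℂ) =
      fderiv ℝ (fun w : ℂ => ρ.density (ofComplex w) * ‖v‖ ^ 2) (z : ℂ)

/-- `E : ℍ → ℍ³` is Epstein's surface of the pair `(ρ, F)`: it is continuous, and for every `z` the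
visual metric from `E z`, pulled back by `F`, agrees at `z` to first order with `ρ`. -/
def IsEpsteinSurface (ρ : ConformalMetric) (F : ℍ → ProjLine) (E : ℍ → HypThree) : Prop :=
  Continuous E ∧ ∀ z : ℍ, OneJetEq (E z) F ρ z

/-- The hyperbolic metric `|dz|² / (Im z)²` of curvature `-1`. -/
def hyperbolicMetric : ConformalMetric where
  density z := 1 / z.im ^ 2
  density_pos z := by have := z.im_pos; positivity
  contDiffOn := by
    have h : ContDiffOn ℝ 1 (fun w : ℂ => 1 / w.im ^ 2) {w : ℂ | 0 < w.im} := by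
      refine ContDiffOn.div contDiffOn_const ?_ ?_
      · exact (Complex.imCLM.contDiff.pow 2).contDiffOn
      · intro w hw
        exact pow_ne_zero 2 (ne_of_gt hw)
    refine h.congr ?_
    intro w hw
    have : ofComplex w = ⟨w, hw⟩ := ofComplex_apply_of_im_pos hw
    simp only [this]
    rfl

/-! ### The Epstein-Poincaré surface of a `PGL(2, ℂ)`-oper

We fix the triplet `e = E₁₂ / √2`, `h = diag(1/2, -1/2)`, `f = E₂₁ / √2` of `𝔰𝔩₂(ℂ)`, for which
`[h, e] = e`, `[h, f] = -f`, `[e, f] = h`, and the Borel subalgebra `⟨h, e⟩`; this is the stabilizer of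
`[1 : 0]`, so that the flag manifold `G / B` is `ℙ¹` with base point `[1 : 0]`. -/

/-- The element `e` of the triplet. -/
def tripletE : Matrix (Fin 2) (Fin 2) ℂ := ((1 / √2 : ℝ) : ℂ) • !![0, 1; 0, 0]

/-- The element `h` of the triplet. -/
def tripletH : Matrix (Fin 2) (Fin 2) ℂ := !![1 / 2, 0; 0, -1 / 2]

/-- The element `f` of the triplet. -/
def tripletF : Matrix (Fin 2) (Fin 2) ℂ := ((1 / √2 : ℝ) : ℂ) • !![0, 0; 1, 0]

/-- The base point `[1 : 0]` of the flag manifold `ℙ¹ = G / B`. -/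
def basePoint : ProjLine :=
  Projectivization.mk ℂ ![1, 0] (fun h => one_ne_zero (congrFun h 0))

/-- The developing map of the Fuchsian oper: the inclusion `z ↦ [z : 1]` of `ℍ` in `ℙ¹`. -/
def fuchsianDev (z : ℍ) : ProjLine :=
  Projectivization.mk ℂ ![(z : ℂ), 1] (fun h => one_ne_zero (congrFun h 1))

/-- `L : ℍ → PGL(2, ℂ)` is the canonical (Drinfeld-Sokolov) lift of `F : ℍ → ℙ¹ = G / B`: locally it
is represented by a holomorphic `M` with `M⁻¹ M' = f + α e` for some function `α`, and it lifts
`F`. -/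
def IsCanonicalLift (F : ℍ → ProjLine) (L : ℍ → PGL(2, ℂ)) : Prop :=
  ∀ z : ℍ, ∃ (M : ℂ → GL (Fin 2) ℂ) (α : ℂ → ℂ), ∀ᶠ w : ℂ in 𝓝 (z : ℂ),
    (∀ i j : Fin 2, HasDerivAt (fun u : ℂ => (M u).val i j)
      (((M w).val * (tripletF + α w • tripletE)) i j) w) ∧
    Matrix.ProjGenLinGroup.mk (M w) = L (ofComplex w) ∧
    L (ofComplex w) • basePoint = F (ofComplex w)

/-- `O` is the osculating map carrying the oper `F₂` to the oper `F₁`: the quotient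
`O = L₁ L₂⁻¹` of the canonical lifts. -/
def IsOperOsc (F₂ F₁ : ℍ → ProjLine) (O : ℍ → PGL(2, ℂ)) : Prop :=
  ∃ L₂ L₁ : ℍ → PGL(2, ℂ), IsCanonicalLift F₂ L₂ ∧ IsCanonicalLift F₁ L₁ ∧
    ∀ z, O z = L₁ z * (L₂ z)⁻¹

/-- The coefficient `H = 1 / (2 (Im z)²)` of the hyperbolic metric `H dz dz̄` of curvature `-2`. -/
def hypCoeff (w : ℂ) : ℝ := 1 / (2 * w.im ^ 2)

/-- The Wirtinger derivative `∂u / ∂z` of a real function `u`. -/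
def wirtinger (u : ℂ → ℝ) (w : ℂ) : ℂ :=
  (1 / 2) * ((fderiv ℝ u w 1 : ℂ) - Complex.I * (fderiv ℝ u w Complex.I : ℂ))

/-- The connection form of the flat connection `D = ∇ + τ ⊗ ad f + H ⊗ ad e` of the Fuchsian bundle
`⨁ Kⁱ ⊗ 𝔤ᵢ`, in the frame `dzⁱ ⊗ xᵢ` (`i = -1, 0, 1`) that identifies this bundle with `ℍ × 𝔰𝔩₂(ℂ)`.
There the Chern connection of `Kⁱ` is `d - i ∂ log H`, so that `D = d + ad ω` with
`ω = (f - (∂ log H / ∂z) h) dz + H e dz̄`; this is its value on the tangent vector `v`. -/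
def fuchsianForm (w v : ℂ) : Matrix (Fin 2) (Fin 2) ℂ :=
  v • (tripletF - wirtinger (fun u => Real.log (hypCoeff u)) w • tripletH) +
    ((starRingEnd ℂ v) * (hypCoeff w : ℂ)) • tripletE

/-- The Cartan involution `Θ⁰` of the Fuchsian bundle at `w`, in the same frame: the antilinear map
with `Θ⁰ (dzⁱ ⊗ xᵢ) = H⁻ⁱ dz⁻ⁱ ⊗ θ xᵢ`, where `θ e = -f`, `θ h = -h`, `θ f = -e`. -/
def fuchsianInvolution (w : ℂ) (X : Matrix (Fin 2) (Fin 2) ℂ) : Matrix (Fin 2) (Fin 2) ℂ :=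
  !![-starRingEnd ℂ (X 0 0), -((hypCoeff w : ℂ) * starRingEnd ℂ (X 1 0));
     -((hypCoeff w : ℂ)⁻¹ * starRingEnd ℂ (X 0 1)), -starRingEnd ℂ (X 1 1)]

/-- The Cartan involution `X ↦ -A Xᴴ A⁻¹` of `𝔰𝔩₂(ℂ)` that corresponds to `A ∈ ℍ³`; this identifies
`ℍ³` with the symmetric space of `PGL(2, ℂ)`, the space of Cartan involutions. -/
def cartanInvolution (A : HypThree) (X : Matrix (Fin 2) (Fin 2) ℂ) : Matrix (Fin 2) (Fin 2) ℂ :=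
  -(A.mat * Xᴴ * A.mat⁻¹)

/-- `S : ℍ → ℍ³` is the surface `Ep⁰` developed from `(Fuchsian bundle, Θ⁰, D)`, in the trivialization
for which the developing map of the Fuchsian oper is the inclusion `z ↦ [z : 1]`. A trivialization
`X ↦ M X M⁻¹` is flat when `dM = M ω`. -/
def IsFuchsianSurface (S : ℍ → HypThree) : Prop :=
  ∃ M : ℍ → GL (Fin 2) ℂ,
    (∀ (z : ℍ) (i j : Fin 2),
      DifferentiableAt ℝ (fun w : ℂ => (M (ofComplex w)).val i j) (z : ℂ) ∧
      ∀ v : ℂ, fderiv ℝ (fun w : ℂ => (M (ofComplex w)).val i j) (z : ℂ) v =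
        ((M z).val * fuchsianForm (z : ℂ) v) i j) ∧
    (∀ z : ℍ, (Matrix.ProjGenLinGroup.mk (M z) : PGL(2, ℂ)) • basePoint = fuchsianDev z) ∧
    ∀ (z : ℍ) (X : Matrix (Fin 2) (Fin 2) ℂ), X.trace = 0 →
      cartanInvolution (S z) ((M z).val * X * (M z).val⁻¹) =
        (M z).val * fuchsianInvolution (z : ℂ) X * (M z).val⁻¹

/-- `S : ℍ → ℍ³` is the Epstein-Poincaré surface of the `PGL(2, ℂ)`-oper with developing map `F`:
`S(z) = Osc(z) • Ep⁰(z)`, where `Osc` carries the Fuchsian oper to `F`. -/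
def IsEPSurface (F : ℍ → ProjLine) (S : ℍ → HypThree) : Prop :=
  ∃ (O : ℍ → PGL(2, ℂ)) (S₀ : ℍ → HypThree), IsOperOsc fuchsianDev F O ∧ IsFuchsianSurface S₀ ∧
    ∀ z, S z = O z • S₀ z

end EP

end

/-!
The proof is organized around frames. Near each point a locally injective holomorphic map
`F : ℍ → ℙ¹` has a lift `P` to `ℂ²` with Wronskian `P₀ P₁' - P₁ P₀' = 1`, unique up to sign, and the
matrix `N = (P | P')`, of determinant one, is called a frame of `F` (`exists_isUnimodularLift`,
`IsFrame`). Its derivative being nonzero, which local injectivity provides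
(`deriv_ne_zero_of_injOn`), is what makes the Wronskian normalizable. Every object of the theorem is
expressed through the class of `N` in `PGL(2, ℂ)`.

* The `2`-jets of `F` and `G` at `z` agree exactly when their frames agree in `PGL(2, ℂ)`
  (`IsFrame.twoJetEq_iff`), and frames are equivariant (`IsFrame.exists_smul`). Hence `N₁ N₂⁻¹` is the
  only osculating map from `F₂` to `F₁`.
* In terms of `P`, the pulled-back visual metric from `A` is `4 |dz|² / (Pᴴ A⁻¹ P)²`. Comparing
  `1`-jets with `ρ |dz|²` prescribes `Pᴴ A⁻¹ P` and `Pᴴ A⁻¹ P'`, which is the first row of the Hermitian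
  matrix `Nᴴ A⁻¹ N` of determinant one, by the `1`-jet of `2 / √ρ`. So the condition on `A` reads
  `A = N • C`, with a point `C` of `ℍ³` that depends on `ρ` and `z` alone (`IsFrame.oneJetEq_iff`).
  This gives existence, uniqueness and continuity of Epstein's surface (`isEpsteinSurface_iff`), and
  `N₁ N₂⁻¹` carries `N₂ • C` to `N₁ • C`.
* The canonical lift of `F` is `N` times a constant diagonal matrix (`IsCanonicalLift.eq_mk`), so the
  map `O` between opers is the osculating map. In the flat trivialization `M` of the Fuchsian bundle,
  the first column `p` is a holomorphic lift of the inclusion with `p' = q / √2 - (i / 2y) p`, and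
  `det M` is constant; hence `M` and the Fuchsian frame differ by an explicit triangular matrix, which
  takes `C` of the hyperbolic metric to the point with Cartan involution `Θ⁰` (`fuchsianGauge_smul`).
  Therefore the Fuchsian surface is `N • C` (`IsFuchsianSurface.eq_smul`), and the Epstein-Poincaré
  surface of `F` is `N • C` for the frame of `F`, which is Epstein's surface.
-/

namespace EP

/-! ### Local roots and local injectivity -/

theorem exists_analyticAt_pow_eq {g : ℂ → ℂ} {z : ℂ} (hg : AnalyticAt ℂ g z) (hz : g z ≠ 0) {n : ℕ}
    (hn : n ≠ 0) :
    ∃ r : ℂ → ℂ, AnalyticAt ℂ r z ∧ r z ≠ 0 ∧ ∀ᶠ w in 𝓝 z, r w ^ n = g w := by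
  obtain ⟨κ, hκ⟩ := IsAlgClosed.exists_pow_nat_eq (g z) (Nat.pos_of_ne_zero hn)
  have hκ0 : κ ≠ 0 := by
    rintro rfl
    exact hz (by rw [← hκ, zero_pow hn])
  refine ⟨fun w => κ * Complex.exp (Complex.log (g w / g z) / n), ?_, ?_, ?_⟩
  · have h1 : AnalyticAt ℂ (fun w => g w / g z) z := hg.div analyticAt_const hz
    have h2 : AnalyticAt ℂ (fun w => Complex.log (g w / g z)) z :=
      h1.clog (by simp [div_self hz])
    exact analyticAt_const.mul ((h2.div analyticAt_const (by exact_mod_cast hn)).cexp)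
  · exact mul_ne_zero hκ0 (Complex.exp_ne_zero _)
  · filter_upwards [hg.continuousAt.eventually_ne hz] with w hw
    rw [mul_pow, hκ, ← Complex.exp_nat_mul, mul_div_cancel₀ _ (by exact_mod_cast hn),
      Complex.exp_log (div_ne_zero hw hz), mul_div_cancel₀ _ hz]

/-- If `f'(z) = 0` and `f` is not constant, then `f - f z` is near `z` the `n`-th power, `n ≥ 2`, of a
local coordinate, and takes the same value at two points where this coordinate differs by an `n`-th
root of unity. -/
theorem deriv_ne_zero_of_injOn {f : ℂ → ℂ} {z : ℂ} {U : Set ℂ} (hf : AnalyticAt ℂ f z)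
    (hU : U ∈ 𝓝 z) (hinj : Set.InjOn f U) : deriv f z ≠ 0 := by
  intro hd
  set k : ℂ → ℂ := fun w => f w - f z with hk
  have hka : AnalyticAt ℂ k z := hf.sub analyticAt_const
  have htop : analyticOrderAt k z ≠ ⊤ := by
    intro h
    rw [analyticOrderAt_eq_top] at h
    have h1 : ∀ᶠ w in 𝓝[≠] z, k w = 0 ∧ w ∈ U ∧ w ≠ z :=
      (h.filter_mono nhdsWithin_le_nhds).and
        ((Filter.Eventually.filter_mono nhdsWithin_le_nhds hU).and self_mem_nhdsWithin)
    obtain ⟨w, hw0, hwU, hwz⟩ := h1.exists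
    exact hwz (hinj hwU (mem_of_mem_nhds hU) (sub_eq_zero.mp hw0))
  obtain ⟨g, hg, hgz, hgk⟩ := hka.analyticOrderAt_ne_top.mp htop
  set n := analyticOrderNatAt k z
  have hn0 : n ≠ 0 := by
    intro h0
    have := hgk.self_of_nhds
    rw [h0] at this
    simp [hk] at this
    exact hgz this.symm
  have hn1 : n ≠ 1 := by
    intro h1
    rw [h1] at hgk
    have h2 : HasDerivAt (fun w => (w - z) ^ 1 • g w) (g z) z := by
      have := ((hasDerivAt_id z).sub_const z).mul hg.differentiableAt.hasDerivAt
      simpa using! this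
    have h3 : HasDerivAt k (g z) z := h2.congr_of_eventuallyEq hgk
    have h4 : HasDerivAt k 0 z := by
      have := hf.differentiableAt.hasDerivAt.sub_const (f z)
      rwa [hd] at this
    exact hgz (h3.unique h4)
  obtain ⟨r, hr, hrz, hrg⟩ := exists_analyticAt_pow_eq hg hgz hn0
  set h : ℂ → ℂ := fun w => (w - z) * r w with hh
  have hha : AnalyticAt ℂ h z := (analyticAt_id.sub analyticAt_const).mul hr
  have hh' : HasDerivAt h (r z) z := by
    have := ((hasDerivAt_id z).sub_const z).mul hr.differentiableAt.hasDerivAt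
    simpa using! this
  have hs : HasStrictDerivAt h (r z) z := by
    rw [← hh'.deriv]; exact hha.hasStrictDerivAt
  have hmap : Filter.map h (𝓝 z) = 𝓝 (h z) := hs.map_nhds_eq hrz
  have hhz : h z = 0 := by simp [hh]
  have hV : ∀ᶠ w in 𝓝 z, w ∈ U ∧ f w - f z = h w ^ n := by
    filter_upwards [hU, hgk, hrg] with w h1 h2 h3
    refine ⟨h1, ?_⟩
    simp only [hh, mul_pow, h3]
    simpa [hk] using h2
  have himg : ∀ᶠ y in 𝓝 (0 : ℂ), ∃ w, (w ∈ U ∧ f w - f z = h w ^ n) ∧ h w = y := by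
    have : h '' {w | w ∈ U ∧ f w - f z = h w ^ n} ∈ 𝓝 (0 : ℂ) := by
      rw [← hhz, ← hmap]
      exact Filter.image_mem_map hV
    filter_upwards [this] with y hy
    exact hy
  set ζ : ℂ := Complex.exp (2 * Real.pi * Complex.I / n)
  have hζ : IsPrimitiveRoot ζ n := Complex.isPrimitiveRoot_exp n hn0
  have hζ1 : ζ ≠ 1 := hζ.ne_one (by omega)
  have htend : Filter.Tendsto (fun y : ℂ => ζ * y) (𝓝 0) (𝓝 0) := by
    have : Continuous fun y : ℂ => ζ * y := by fun_prop
    simpa using this.tendsto 0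
  have h1 : ∀ᶠ y in 𝓝[≠] (0 : ℂ), (∃ w, (w ∈ U ∧ f w - f z = h w ^ n) ∧ h w = y) ∧
      (∃ w, (w ∈ U ∧ f w - f z = h w ^ n) ∧ h w = ζ * y) ∧ y ≠ 0 :=
    (himg.filter_mono nhdsWithin_le_nhds).and
      (((htend.eventually himg).filter_mono nhdsWithin_le_nhds).and self_mem_nhdsWithin)
  obtain ⟨y, ⟨w₁, ⟨hw₁, hf₁⟩, hy₁⟩, ⟨w₂, ⟨hw₂, hf₂⟩, hy₂⟩, hy⟩ := h1.exists
  have heq : f w₁ = f w₂ := by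
    rw [hy₁] at hf₁
    rw [hy₂, mul_pow, hζ.pow_eq_one, one_mul, ← hf₁] at hf₂
    exact (sub_left_injective hf₂).symm
  have hw := hinj hw₁ hw₂ heq
  rw [hw, hy₂] at hy₁
  exact hζ1 (mul_right_cancel₀ hy (by rw [hy₁, one_mul]))

end EP

namespace EP

/-! ### Unimodular lifts and frames -/

/-- `P : ℂ → ℂ²` is a unimodular lift of `F` near `z`: it is holomorphic near `z`, projects to `F`,
and its Wronskian `P₀ P₁' - P₁ P₀'` is `1`. -/
def IsUnimodularLift (F : ℍ → ProjLine) (z : ℍ) (P : ℂ → Fin 2 → ℂ) : Prop :=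
  ∀ᶠ w in 𝓝 (z : ℂ), (∀ i, DifferentiableAt ℂ (fun u => P u i) w) ∧
    P w 0 * deriv (fun u => P u 1) w - P w 1 * deriv (fun u => P u 0) w = 1 ∧
    ∃ h : P w ≠ 0, F (ofComplex w) = Projectivization.mk ℂ (P w) h

/-- The matrix with columns `P` and `P'`. -/
noncomputable def frameMatrix (P : ℂ → Fin 2 → ℂ) (w : ℂ) : Matrix (Fin 2) (Fin 2) ℂ :=
  !![P w 0, deriv (fun u => P u 0) w; P w 1, deriv (fun u => P u 1) w]

/-- `N` is a frame of `F` at `z`: the value at `z` of the matrix with columns `P` and `P'`, for a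
unimodular lift `P` of `F`. It is determined up to sign and is equivalent to the `2`-jet of `F`. -/
def IsFrame (F : ℍ → ProjLine) (z : ℍ) (N : GL (Fin 2) ℂ) : Prop :=
  ∃ P, IsUnimodularLift F z P ∧ N.val = frameMatrix P z

theorem eq_or_eq_one_sub : ∀ j i : Fin 2, j = i ∨ j = 1 - i := by decide

theorem one_sub_ne : ∀ i : Fin 2, 1 - i ≠ i := by decide

theorem inChart_mk {i : Fin 2} {v : Fin 2 → ℂ} (h : v ≠ 0) :
    InChart i (Projectivization.mk ℂ v h) ↔ v i ≠ 0 := by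
  obtain ⟨a, ha⟩ := Projectivization.exists_smul_eq_mk_rep ℂ v h
  have ha0 : (a : ℂ) ≠ 0 := a.ne_zero
  rw [InChart, ← ha]
  simp [Units.smul_def, ha0]

theorem coord_mk {i : Fin 2} {v : Fin 2 → ℂ} (h : v ≠ 0) :
    coord i (Projectivization.mk ℂ v h) = v (1 - i) / v i := by
  obtain ⟨a, ha⟩ := Projectivization.exists_smul_eq_mk_rep ℂ v h
  have ha0 : (a : ℂ) ≠ 0 := a.ne_zero
  rw [coord, ← ha]
  simp [Units.smul_def, mul_div_mul_left _ _ ha0]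

theorem eventually_im_pos (z : ℍ) : ∀ᶠ w in 𝓝 (z : ℂ), 0 < w.im :=
  (isOpen_lt continuous_const Complex.continuous_im).eventually_mem z.im_pos

theorem frameMatrix_det (P : ℂ → Fin 2 → ℂ) (w : ℂ) : (frameMatrix P w).det =
    P w 0 * deriv (fun u => P u 1) w - P w 1 * deriv (fun u => P u 0) w := by
  rw [frameMatrix, Matrix.det_fin_two_of]; ring

namespace IsUnimodularLift

variable {F G : ℍ → ProjLine} {z : ℍ} {P Q : ℂ → Fin 2 → ℂ}

theorem analyticAt (hP : IsUnimodularLift F z P) (i : Fin 2) :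
    AnalyticAt ℂ (fun u => P u i) z :=
  Complex.analyticAt_iff_eventually_differentiableAt.mpr (hP.mono fun _ hw => hw.1 i)

theorem det_eq (hP : IsUnimodularLift F z P) : (frameMatrix P z).det = 1 := by
  rw [frameMatrix_det]; exact hP.self_of_nhds.2.1

/-- A unimodular lift near `z` is one near all points close to `z`. -/
theorem eventually_nhds (hP : IsUnimodularLift F z P) :
    ∀ᶠ w in 𝓝 (z : ℂ), IsUnimodularLift F (ofComplex w) P := by
  filter_upwards [eventually_eventually_nhds.mpr hP, eventually_im_pos z] with w hw him
  have : ((ofComplex w : ℍ) : ℂ) = w := by rw [ofComplex_apply_of_im_pos him]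
  rw [IsUnimodularLift, this]
  exact hw

theorem exists_frame (hP : IsUnimodularLift F z P) :
    ∃ N : GL (Fin 2) ℂ, N.val = frameMatrix P z ∧ IsFrame F z N :=
  ⟨Matrix.GeneralLinearGroup.mkOfDetNeZero (frameMatrix P z)
    (by rw [hP.det_eq]; exact one_ne_zero), rfl, P, hP, rfl⟩

theorem exists_isFrame (hP : IsUnimodularLift F z P) : ∃ N, IsFrame F z N := by
  obtain ⟨N, -, hN⟩ := hP.exists_frame
  exact ⟨N, hN⟩

theorem value (hP : IsUnimodularLift F z P) :
    ∃ h : P z ≠ 0, F z = Projectivization.mk ℂ (P z) h := by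
  obtain ⟨-, -, h, h'⟩ := hP.self_of_nhds
  exact ⟨h, by rwa [ofComplex_apply] at h'⟩

/-- The Wronskian identity in the chart `i`, with its sign. -/
theorem wronskian (hP : IsUnimodularLift F z P) (i : Fin 2) : ∀ᶠ w in 𝓝 (z : ℂ),
    P w i * deriv (fun u => P u (1 - i)) w - P w (1 - i) * deriv (fun u => P u i) w =
      (-1) ^ (i : ℕ) := by
  filter_upwards [hP] with w hw
  fin_cases i
  · simpa using hw.2.1
  · simp; linear_combination -hw.2.1

/-- In terms of a unimodular lift, the coordinate `P₁₋ᵢ / Pᵢ` has derivative `± 1 / Pᵢ²`. -/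
theorem jets (hP : IsUnimodularLift F z P) {i : Fin 2} (hi : P z i ≠ 0) :
    iteratedDeriv 0 (fun w : ℂ => coord i (F (ofComplex w))) (z : ℂ) = P z (1 - i) / P z i ∧
    iteratedDeriv 1 (fun w : ℂ => coord i (F (ofComplex w))) (z : ℂ) =
      (-1) ^ (i : ℕ) / P z i ^ 2 ∧
    iteratedDeriv 2 (fun w : ℂ => coord i (F (ofComplex w))) (z : ℂ) =
      (-1) ^ (i : ℕ) * (-2 * deriv (fun u => P u i) z / P z i ^ 3) := by
  have h0 : (fun w : ℂ => coord i (F (ofComplex w))) =ᶠ[𝓝 (z : ℂ)]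
      fun w => P w (1 - i) / P w i := by
    filter_upwards [hP] with w hw
    obtain ⟨h, h'⟩ := hw.2.2
    rw [h', coord_mk]
  have h1 : deriv (fun w : ℂ => coord i (F (ofComplex w))) =ᶠ[𝓝 (z : ℂ)]
      fun w => (-1) ^ (i : ℕ) / P w i ^ 2 := by
    filter_upwards [h0.eventuallyEq_nhds, hP, hP.wronskian i,
      (hP.analyticAt i).continuousAt.eventually_ne hi] with w hw hw1 hw2 hw3
    rw [hw.deriv_eq]
    rw [((hw1.1 (1 - i)).hasDerivAt.fun_div (hw1.1 i).hasDerivAt hw3).deriv, ← hw2]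
    ring
  refine ⟨?_, ?_, ?_⟩
  · rw [iteratedDeriv_zero]; exact h0.self_of_nhds
  · rw [iteratedDeriv_one]; exact h1.self_of_nhds
  · rw [iteratedDeriv_succ, iteratedDeriv_one, h1.deriv_eq]
    have hd := (hP.self_of_nhds.1 i).hasDerivAt
    rw [((hasDerivAt_const (z : ℂ) ((-1 : ℂ) ^ (i : ℕ))).fun_div (hd.fun_pow 2)
      (pow_ne_zero 2 hi)).deriv]
    field_simp
    push_cast
    ring

/-- Two unimodular lifts have, up to a common sign, the same value and derivative at `z` exactly when
the maps have the same `2`-jet at `z`. -/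
theorem twoJetEq_iff (hP : IsUnimodularLift F z P) (hQ : IsUnimodularLift G z Q) :
    TwoJetEq F G z ↔ ∃ s : ℂ, s ^ 2 = 1 ∧ ∀ i, P z i = s * Q z i ∧
      deriv (fun u => P u i) z = s * deriv (fun u => Q u i) z := by
  obtain ⟨hP1, hPF⟩ := hP.value
  obtain ⟨hQ0, hQG⟩ := hQ.value
  constructor
  · rintro ⟨hFG, hjet⟩
    obtain ⟨i, hi⟩ := Function.ne_iff.mp hP1
    have hPi : P z i ≠ 0 := hi
    have hFi : InChart i (F z) := by rw [hPF]; exact (inChart_mk hP1).mpr hi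
    have hQi : Q z i ≠ 0 := by
      rw [hFG, hQG] at hFi; exact (inChart_mk hQ0).mp hFi
    have j0 := hjet i hFi 0 (by norm_num)
    have j1 := hjet i hFi 1 (by norm_num)
    have j2 := hjet i hFi 2 le_rfl
    obtain ⟨p0, p1, p2⟩ := hP.jets hPi
    obtain ⟨q0, q1, q2⟩ := hQ.jets hQi
    rw [p0, q0] at j0
    rw [p1, q1] at j1
    rw [p2, q2] at j2
    have hε : ((-1 : ℂ) ^ (i : ℕ)) ≠ 0 := pow_ne_zero _ (by norm_num)
    have wP := (hP.wronskian i).self_of_nhds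
    have wQ := (hQ.wronskian i).self_of_nhds
    obtain ⟨s, hs⟩ : ∃ s : ℂ, P z i = s * Q z i := ⟨P z i / Q z i, by field_simp⟩
    have hs0 : s ≠ 0 := by rintro rfl; exact hPi (by simpa using hs)
    -- the first derivatives give the sign, the second ones the derivative of `Pᵢ`
    have hs2 : s ^ 2 = 1 := by
      rw [hs] at j1
      field_simp at j1
      exact j1.symm
    have hb : P z (1 - i) = s * Q z (1 - i) := by
      rw [hs] at j0
      field_simp at j0
      linear_combination j0
    have ha' : deriv (fun u => P u i) z = s * deriv (fun u => Q u i) z := by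
      rw [hs] at j2
      have j2' := mul_left_cancel₀ hε j2
      field_simp at j2'
      have hs3 : s ^ 3 = s := by linear_combination s * hs2
      rw [hs3] at j2'
      linear_combination -j2'
    -- the derivative of the other component follows from the Wronskian identity
    have hb' : deriv (fun u => P u (1 - i)) z = s * deriv (fun u => Q u (1 - i)) z := by
      rw [hs, hb, ha', ← wQ] at wP
      have : s * Q z i * (deriv (fun u => P u (1 - i)) z - s * deriv (fun u => Q u (1 - i)) z) = 0 := by
        linear_combination wP + (Q z (1 - i) * deriv (fun u => Q u i) z -
          Q z i * deriv (fun u => Q u (1 - i)) z) * hs2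
      have := (mul_eq_zero.mp this).resolve_left (mul_ne_zero hs0 hQi)
      exact sub_eq_zero.mp this
    refine ⟨s, hs2, fun j => ?_⟩
    rcases eq_or_eq_one_sub j i with rfl | rfl
    · exact ⟨hs, ha'⟩
    · exact ⟨hb, hb'⟩
  · rintro ⟨s, hs2, hs⟩
    have hs0 : s ≠ 0 := by rintro rfl; norm_num at hs2
    refine ⟨?_, fun i hi k hk => ?_⟩
    · rw [hPF, hQG, Projectivization.mk_eq_mk_iff']
      exact ⟨s, by ext i; simp [(hs i).1]⟩
    · have hPi : P z i ≠ 0 := by rw [hPF] at hi; exact (inChart_mk hP1).mp hi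
      have hQi : Q z i ≠ 0 := by
        intro h; exact hPi (by rw [(hs i).1, h, mul_zero])
      obtain ⟨p0, p1, p2⟩ := hP.jets hPi
      obtain ⟨q0, q1, q2⟩ := hQ.jets hQi
      have hs3 : s ^ 3 = s := by linear_combination s * hs2
      interval_cases k
      · rw [p0, q0, (hs i).1, (hs (1 - i)).1, mul_div_mul_left _ _ hs0]
      · rw [p1, q1, (hs i).1, mul_pow, hs2, one_mul]
      · rw [p2, q2, (hs i).1, (hs i).2, mul_pow, hs3]
        field_simp

end IsUnimodularLift

theorem scalar_mul_val (N : GL (Fin 2) ℂ) (u : ℂˣ) :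
    (N * Matrix.GeneralLinearGroup.scalar (Fin 2) u).val = (u : ℂ) • N.val := by
  ext i j
  fin_cases i <;> fin_cases j <;> simp [Matrix.mul_apply, Matrix.scalar, mul_comm]

theorem mk_eq_mk_of_val_eq_smul {N N' : GL (Fin 2) ℂ} {c : ℂ} (hc : c ≠ 0)
    (h : N'.val = c • N.val) :
    (Matrix.ProjGenLinGroup.mk N : PGL(2, ℂ)) = Matrix.ProjGenLinGroup.mk N' := by
  rw [Matrix.ProjGenLinGroup.mk_eq_mk_iff]
  exact ⟨Units.mk0 c hc, Units.ext (by rw [scalar_mul_val, h]; rfl)⟩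

theorem IsFrame.det_eq {F : ℍ → ProjLine} {z : ℍ} {N : GL (Fin 2) ℂ} (hN : IsFrame F z N) :
    N.val.det = 1 := by
  obtain ⟨P, hP, h⟩ := hN
  rw [h, hP.det_eq]

/-- Frames classify `2`-jets of local diffeomorphisms: in `PGL(2, ℂ)`, they are equal exactly when
the `2`-jets are. -/
theorem IsFrame.twoJetEq_iff {F G : ℍ → ProjLine} {z : ℍ} {N N' : GL (Fin 2) ℂ}
    (hN : IsFrame F z N) (hN' : IsFrame G z N') :
    TwoJetEq F G z ↔
      (Matrix.ProjGenLinGroup.mk N : PGL(2, ℂ)) = Matrix.ProjGenLinGroup.mk N' := by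
  have hd := hN.det_eq
  have hd' := hN'.det_eq
  obtain ⟨P, hP, h⟩ := hN
  obtain ⟨Q, hQ, h'⟩ := hN'
  rw [hP.twoJetEq_iff hQ]
  constructor
  · rintro ⟨s, hs2, hs⟩
    refine (mk_eq_mk_of_val_eq_smul (c := s) (by rintro rfl; norm_num at hs2) ?_).symm
    rw [h, h']
    ext i j
    fin_cases i <;> fin_cases j <;> simp [frameMatrix, (hs _).1, (hs _).2]
  · intro hmk
    rw [eq_comm, Matrix.ProjGenLinGroup.mk_eq_mk_iff] at hmk
    obtain ⟨u, hu⟩ := hmk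
    have hv : N.val = (u : ℂ) • N'.val := by rw [← hu, scalar_mul_val]
    have hu2 : (u : ℂ) ^ 2 = 1 := by
      rw [hv, Matrix.det_smul, hd', mul_one] at hd
      simpa using hd
    refine ⟨u, hu2, fun i => ?_⟩
    rw [h, h'] at hv
    have e0 := congrFun (congrFun hv i) 0
    have e1 := congrFun (congrFun hv i) 1
    fin_cases i <;> exact ⟨by simpa [frameMatrix] using e0, by simpa [frameMatrix] using e1⟩

theorem IsFrame.mk_eq {F : ℍ → ProjLine} {z : ℍ} {N N' : GL (Fin 2) ℂ}
    (hN : IsFrame F z N) (hN' : IsFrame F z N') :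
    (Matrix.ProjGenLinGroup.mk N : PGL(2, ℂ)) = Matrix.ProjGenLinGroup.mk N' :=
  (hN.twoJetEq_iff hN').mp ⟨rfl, fun _ _ _ _ => rfl⟩

/-- A lift with locally constant nonzero Wronskian becomes unimodular after rescaling. -/
theorem exists_isFrame_of_wronskian_const {F : ℍ → ProjLine} {z : ℍ} {P : ℂ → Fin 2 → ℂ} {D : ℂ}
    (hD : D ≠ 0)
    (h : ∀ᶠ w in 𝓝 (z : ℂ), (∀ i, DifferentiableAt ℂ (fun u => P u i) w) ∧
      P w 0 * deriv (fun u => P u 1) w - P w 1 * deriv (fun u => P u 0) w = D ∧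
      ∃ h : P w ≠ 0, F (ofComplex w) = Projectivization.mk ℂ (P w) h) :
    ∃ (N : GL (Fin 2) ℂ) (κ : ℂ), κ ≠ 0 ∧ IsFrame F z N ∧ N.val = κ • frameMatrix P z := by
  obtain ⟨κ, hκ⟩ := IsAlgClosed.exists_pow_nat_eq D⁻¹ (n := 2) two_pos
  have hκ0 : κ ≠ 0 := by
    rintro rfl; exact inv_ne_zero hD (by rw [← hκ]; ring)
  have hder : ∀ i w, DifferentiableAt ℂ (fun u => P u i) w →
      deriv (fun u => (κ • P u) i) w = κ * deriv (fun u => P u i) w := by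
    intro i w hw
    exact deriv_const_mul κ hw
  have hlift : IsUnimodularLift F z (fun w => κ • P w) := by
    filter_upwards [h] with w hw
    refine ⟨fun i => by simpa using (hw.1 i).const_mul κ, ?_, smul_ne_zero hκ0 hw.2.2.1, ?_⟩
    · rw [hder _ _ (hw.1 0), hder _ _ (hw.1 1)]
      simp only [Pi.smul_apply, smul_eq_mul]
      have : κ ^ 2 * D = 1 := by rw [hκ, inv_mul_cancel₀ hD]
      rw [← this, ← hw.2.1]; ring
    · obtain ⟨h, h'⟩ := hw.2.2
      refine h'.trans ?_
      rw [Projectivization.mk_eq_mk_iff']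
      exact ⟨κ⁻¹, by rw [smul_smul, inv_mul_cancel₀ hκ0, one_smul]⟩
  obtain ⟨N, hNv, hN⟩ := hlift.exists_frame
  refine ⟨N, κ, hκ0, hN, ?_⟩
  rw [hNv]
  have hz := h.self_of_nhds.1
  ext i j
  fin_cases i <;> fin_cases j <;> simp [frameMatrix]

/-- A locally injective holomorphic map has a unimodular lift near every point: divide the lift
given by an affine chart by a square root of its Wronskian. -/
theorem exists_isUnimodularLift {F : ℍ → ProjLine} (hol : Holomorphic F) (inj : LocallyInjective F)
    (z : ℍ) : ∃ P, IsUnimodularLift F z P := by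
  obtain ⟨i, hi⟩ := hol z
  set f : ℂ → ℂ := fun u => coord i (F (ofComplex u)) with hfdef
  have hfa : AnalyticAt ℂ f z :=
    Complex.analyticAt_iff_eventually_differentiableAt.mpr (hi.mono fun _ hw => hw.2)
  obtain ⟨U, hU, hUinj⟩ := inj z
  have hcont : Filter.Tendsto (fun w : ℂ => ofComplex w) (𝓝 (z : ℂ)) (𝓝 z) := by
    have := (contMDiffAt_ofComplex (n := 0) z.im_pos).continuousAt.tendsto
    rwa [ofComplex_apply] at this
  have hmk : ∀ w : ℂ, InChart i (F (ofComplex w)) →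
      ∀ v : Fin 2 → ℂ, v i ≠ 0 → v (1 - i) = f w * v i →
      ∃ h : v ≠ 0, F (ofComplex w) = Projectivization.mk ℂ v h := by
    intro w hw v hv hv'
    have hv0 : v ≠ 0 := by rintro rfl; exact hv rfl
    refine ⟨hv0, ?_⟩
    rw [← (F (ofComplex w)).mk_rep, Projectivization.mk_eq_mk_iff']
    have hw' : (F (ofComplex w)).rep i ≠ 0 := hw
    refine ⟨(F (ofComplex w)).rep i / v i, ?_⟩
    ext j
    rcases eq_or_eq_one_sub j i with rfl | rfl
    · simp; field_simp
    · simp only [Pi.smul_apply, smul_eq_mul, hv', hfdef, coord]; field_simp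
  have hderiv : deriv f z ≠ 0 := by
    refine deriv_ne_zero_of_injOn hfa (U := {w | InChart i (F (ofComplex w)) ∧ ofComplex w ∈ U ∧
      0 < w.im}) ?_ ?_
    · filter_upwards [hi, hcont.eventually hU, eventually_im_pos z] with w h1 h2 h3
      exact ⟨h1.1, h2, h3⟩
    · rintro a ⟨ha, haU, ham⟩ b ⟨hb, hbU, hbm⟩ hab
      have hF : F (ofComplex a) = F (ofComplex b) := by
        set v : Fin 2 → ℂ := fun j => if j = i then 1 else f a with hv
        have h1 : v i = 1 := by simp [hv]
        have h2 : v (1 - i) = f a := by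
          simp [hv, one_sub_ne i]
        obtain ⟨_, e1⟩ := hmk a ha v (by simp [h1]) (by simp [h1, h2])
        obtain ⟨_, e2⟩ := hmk b hb v (by simp [h1]) (by rw [h1, h2, hab, mul_one])
        rw [e1, e2]
      have := hUinj haU hbU hF
      rw [ofComplex_apply_of_im_pos ham, ofComplex_apply_of_im_pos hbm] at this
      exact congrArg UpperHalfPlane.coe this
  set ε : ℂ := (-1) ^ (i : ℕ) with hε
  have hε0 : ε ≠ 0 := pow_ne_zero _ (by norm_num)
  obtain ⟨r, hr, hrz, hrg⟩ := exists_analyticAt_pow_eq (g := fun w => ε * (deriv f w)⁻¹)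
    (analyticAt_const.mul (hfa.deriv.inv hderiv)) (mul_ne_zero hε0 (inv_ne_zero hderiv)) two_ne_zero
  refine ⟨fun w j => if j = i then r w else f w * r w, ?_⟩
  have hε2 : ε * ε = 1 := by rw [hε, ← mul_pow]; norm_num
  filter_upwards [hi, hrg, hr.eventually_analyticAt, hfa.eventually_analyticAt,
    hr.continuousAt.eventually_ne hrz, hfa.deriv.continuousAt.eventually_ne hderiv]
    with w h1 h2 h3 h4 h5 h6
  have h2' : r w ^ 2 * deriv f w = ε := by rw [h2]; field_simp
  have hd := (h4.differentiableAt.hasDerivAt.mul h3.differentiableAt.hasDerivAt)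
  have hne := one_sub_ne i
  refine ⟨fun j => ?_, ?_, hmk w h1.1 _ (by simpa using h5) (by simp [hne])⟩
  · by_cases hj : j = i
    · simpa [hj] using h3.differentiableAt
    · simpa [hj] using h4.differentiableAt.fun_mul h3.differentiableAt
  · have hd' : deriv (fun u => f u * r u) w = deriv f w * r w + f w * deriv r w := hd.deriv
    fin_cases i
    · simp [hε] at h2' ⊢
      rw [hd']
      linear_combination h2'
    · simp [hε] at h2' ⊢
      rw [hd']
      linear_combination -h2'

/-- Frames are equivariant: `g N` is, up to a scalar, a frame of `g ∘ F`. -/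
theorem IsFrame.exists_smul {F : ℍ → ProjLine} {z : ℍ} {N : GL (Fin 2) ℂ} (hN : IsFrame F z N)
    (g : PGL(2, ℂ)) : ∃ N', IsFrame (fun w => g • F w) z N' ∧
      Matrix.ProjGenLinGroup.mk N' = g * Matrix.ProjGenLinGroup.mk N := by
  obtain ⟨P, hP, hNP⟩ := hN
  induction g using Matrix.ProjGenLinGroup.induction_on with | mk g =>
  have hg : g.val.det ≠ 0 := g.det.ne_zero
  have hval : ∀ w i, (g • P w) i = g.val i 0 * P w 0 + g.val i 1 * P w 1 := by
    intro w i
    change (g.val *ᵥ P w) i = _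
    simp [Matrix.mulVec, dotProduct, Fin.sum_univ_two]
  have hdiff : ∀ w, (∀ i, DifferentiableAt ℂ (fun u => P u i) w) → ∀ i,
      HasDerivAt (fun u => (g • P u) i) (g.val i 0 * deriv (fun u => P u 0) w +
        g.val i 1 * deriv (fun u => P u 1) w) w := by
    intro w hw i
    simp only [hval]
    exact ((hw 0).hasDerivAt.const_mul _).add ((hw 1).hasDerivAt.const_mul _)
  obtain ⟨N', κ, hκ, hN', hv⟩ := exists_isFrame_of_wronskian_const
    (F := fun w => (Matrix.ProjGenLinGroup.mk g : PGL(2, ℂ)) • F w) (z := z)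
    (P := fun w => g • P w) hg (by
      filter_upwards [hP] with w hw
      refine ⟨fun i => (hdiff w hw.1 i).differentiableAt, ?_, ?_⟩
      · rw [(hdiff w hw.1 0).deriv, (hdiff w hw.1 1).deriv, hval, hval, Matrix.det_fin_two]
        linear_combination (g.val 0 0 * g.val 1 1 - g.val 0 1 * g.val 1 0) * hw.2.1
      · obtain ⟨h, h'⟩ := hw.2.2
        exact ⟨(smul_ne_zero_iff_ne g).mpr h, by rw [h']; rfl⟩)
  refine ⟨N', hN', ?_⟩
  rw [← map_mul]
  refine (mk_eq_mk_of_val_eq_smul hκ ?_).symm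
  rw [hv, Units.val_mul, hNP]
  congr 1
  have hz := fun i => (hdiff _ hP.self_of_nhds.1 i).deriv
  simp only [hval] at hz
  ext i j
  fin_cases i <;> fin_cases j <;>
    simp [frameMatrix, Matrix.mul_apply, Fin.sum_univ_two, hval, hz]

end EP

namespace EP

/-! ### Wirtinger derivatives -/

/-- `f` is real differentiable at `w`, with `∂f/∂z = a` and `∂f/∂z̄ = b`. -/
def HasWirtingerAt (f : ℂ → ℂ) (a b w : ℂ) : Prop :=
  HasFDerivAt f (a • (1 : ℂ →L[ℝ] ℂ) + b • (Complex.conjCLE : ℂ →L[ℝ] ℂ)) w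

namespace HasWirtingerAt

variable {f g : ℂ → ℂ} {a b c d w : ℂ}

theorem fderiv_apply (hf : HasWirtingerAt f a b w) (v : ℂ) :
    fderiv ℝ f w v = a * v + b * starRingEnd ℂ v := by
  rw [HasFDerivAt.fderiv hf]; simp

theorem differentiableAt (hf : HasWirtingerAt f a b w) : DifferentiableAt ℝ f w :=
  HasFDerivAt.differentiableAt hf

theorem of_fderiv (hf : DifferentiableAt ℝ f w)
    (h : ∀ v, fderiv ℝ f w v = a * v + b * starRingEnd ℂ v) : HasWirtingerAt f a b w := by
  have h1 := hf.hasFDerivAt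
  rw [HasWirtingerAt]
  convert h1 using 1
  ext v
  simp [h]

theorem _root_.HasDerivAt.hasWirtingerAt (hf : HasDerivAt f a w) : HasWirtingerAt f a 0 w := by
  have h := hf.complexToReal_fderiv
  refine of_fderiv h.differentiableAt fun v => ?_
  rw [h.fderiv]; simp

theorem hasDerivAt (hf : HasWirtingerAt f a 0 w) : HasDerivAt f a w := by
  have : HasFDerivAt f (a • (1 : ℂ →L[ℂ] ℂ)) w :=
    hasFDerivAt_of_restrictScalars ℝ hf.differentiableAt.hasFDerivAt
      (ContinuousLinearMap.ext fun v => by rw [hf.fderiv_apply]; simp)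
  simpa using this.hasDerivAt

theorem const (k : ℂ) : HasWirtingerAt (fun _ => k) 0 0 w :=
  (hasDerivAt_const w k).hasWirtingerAt

theorem congr (hf : HasWirtingerAt f a b w) (h : g =ᶠ[𝓝 w] f) : HasWirtingerAt g a b w :=
  HasFDerivAt.congr_of_eventuallyEq hf h

theorem unique (hf : HasWirtingerAt f a b w) (hf' : HasWirtingerAt f c d w) : a = c ∧ b = d := by
  have h1 := hf.fderiv_apply 1
  have h2 := hf.fderiv_apply Complex.I
  rw [hf'.fderiv_apply] at h1 h2
  simp at h1 h2
  have hI := Complex.I_mul_I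
  constructor
  · linear_combination (-1 / 2) * h1 + (Complex.I / 2) * h2 + (d - c + a - b) / 2 * hI
  · linear_combination (-1 / 2) * h1 - (Complex.I / 2) * h2 - (d - c + a - b) / 2 * hI

theorem add (hf : HasWirtingerAt f a b w) (hg : HasWirtingerAt g c d w) :
    HasWirtingerAt (fun u => f u + g u) (a + c) (b + d) w := by
  have h := HasFDerivAt.add hf hg
  refine of_fderiv h.differentiableAt fun v => ?_
  rw [show (fun u => f u + g u) = f + g from rfl, h.fderiv]; simp; ring

theorem neg (hf : HasWirtingerAt f a b w) : HasWirtingerAt (fun u => -f u) (-a) (-b) w := by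
  have h := HasFDerivAt.neg hf
  refine of_fderiv h.differentiableAt fun v => ?_
  rw [show (fun u => -f u) = -f from rfl, h.fderiv]; simp; ring

theorem sub (hf : HasWirtingerAt f a b w) (hg : HasWirtingerAt g c d w) :
    HasWirtingerAt (fun u => f u - g u) (a - c) (b - d) w := by
  simpa only [sub_eq_add_neg] using hf.add hg.neg

theorem mul (hf : HasWirtingerAt f a b w) (hg : HasWirtingerAt g c d w) :
    HasWirtingerAt (fun u => f u * g u) (a * g w + f w * c) (b * g w + f w * d) w := by
  have h := HasFDerivAt.mul hf hg
  refine of_fderiv h.differentiableAt fun v => ?_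
  have h' := h.fderiv
  rw [show (fun u => f u * g u) = f * g from rfl, h']; simp; ring

theorem conj (hf : HasWirtingerAt f a b w) :
    HasWirtingerAt (fun u => starRingEnd ℂ (f u)) (starRingEnd ℂ b) (starRingEnd ℂ a) w := by
  have h := (Complex.conjCLE : ℂ →L[ℝ] ℂ).hasFDerivAt.comp w hf
  refine of_fderiv h.differentiableAt fun v => ?_
  have h' := h.fderiv
  rw [show (fun u => starRingEnd ℂ (f u)) = (Complex.conjCLE : ℂ →L[ℝ] ℂ) ∘ f from rfl, h']
  simp; ring

theorem inv (hf : HasWirtingerAt f a b w) (h0 : f w ≠ 0) :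
    HasWirtingerAt (fun u => (f u)⁻¹) (-a / f w ^ 2) (-b / f w ^ 2) w := by
  have h1 : HasFDerivAt (fun x : ℂ => x⁻¹) _ (f w) :=
    (hasDerivAt_inv h0).complexToReal_fderiv
  have h := h1.comp w hf
  refine of_fderiv h.differentiableAt fun v => ?_
  have h' := h.fderiv
  rw [show (fun u => (f u)⁻¹) = (fun x : ℂ => x⁻¹) ∘ f from rfl, h']
  simp; field_simp

end HasWirtingerAt

theorem hasWirtingerAt_ofReal {u : ℂ → ℝ} {w : ℂ} (hu : DifferentiableAt ℝ u w) :
    HasWirtingerAt (fun x => (u x : ℂ)) (wirtinger u w) (starRingEnd ℂ (wirtinger u w)) w := by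
  have h := Complex.ofRealCLM.hasFDerivAt.comp w hu.hasFDerivAt
  refine .of_fderiv h.differentiableAt fun v => ?_
  have h' := h.fderiv
  rw [show (fun x => (u x : ℂ)) = Complex.ofRealCLM ∘ u from rfl, h']
  have hv : v = v.re • (1 : ℂ) + v.im • Complex.I := by simp [Complex.re_add_im]
  have hL : fderiv ℝ u w v = v.re * fderiv ℝ u w 1 + v.im * fderiv ℝ u w Complex.I := by
    conv_lhs => rw [hv]
    rw [map_add, map_smul, map_smul, smul_eq_mul, smul_eq_mul]
  simp [hL, wirtinger]
  apply Complex.ext <;> simp <;> ring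

theorem fderiv_eq_iff_wirtinger_eq {u u' : ℂ → ℝ} {w : ℂ} (hu : DifferentiableAt ℝ u w)
    (hu' : DifferentiableAt ℝ u' w) :
    fderiv ℝ u w = fderiv ℝ u' w ↔ wirtinger u w = wirtinger u' w := by
  constructor
  · intro h; rw [wirtinger, wirtinger, h]
  · intro h
    ext v
    have key : ∀ {s : ℂ → ℝ}, DifferentiableAt ℝ s w → ((fderiv ℝ s w v : ℝ) : ℂ) =
        wirtinger s w * v + starRingEnd ℂ (wirtinger s w) * starRingEnd ℂ v := by
      intro s hs
      rw [← (hasWirtingerAt_ofReal hs).fderiv_apply]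
      have h := Complex.ofRealCLM.hasFDerivAt.comp w hs.hasFDerivAt
      rw [show (fun x => (s x : ℂ)) = Complex.ofRealCLM ∘ s from rfl, h.fderiv]
      rfl
    have h1 := key hu
    have h2 := key hu'
    rw [h] at h1
    exact_mod_cast h1.trans h2.symm

end EP

namespace EP

/-! ### Visual metrics in terms of unimodular lifts -/

theorem HypThree.mat_one_zero (A : HypThree) : A.mat 1 0 = starRingEnd ℂ (A.mat 0 1) :=
  (A.posDef.isHermitian.apply 1 0).symm

theorem HypThree.conj_diag (A : HypThree) (i : Fin 2) : starRingEnd ℂ (A.mat i i) = A.mat i i :=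
  A.posDef.isHermitian.apply i i

theorem HypThree.det_expand (A : HypThree) :
    A.mat 0 0 * A.mat 1 1 - A.mat 0 1 * A.mat 1 0 = 1 := by
  rw [← Matrix.det_fin_two, A.det_eq]

theorem HypThree.inv_mat (A : HypThree) :
    A.mat⁻¹ = !![A.mat 1 1, -A.mat 0 1; -A.mat 1 0, A.mat 0 0] := by
  rw [Matrix.inv_def, A.det_eq, Matrix.adjugate_fin_two]; simp

theorem HypThree.mat_diag_ne_zero (A : HypThree) (i : Fin 2) : A.mat i i ≠ 0 :=
  (A.posDef.diag_pos (i := i)).ne'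

/-- A point of `ℍ³` is determined by the second column of its matrix. -/
theorem HypThree.ext_col {A B : HypThree} (h1 : A.mat 1 1 = B.mat 1 1)
    (h0 : A.mat 0 1 = B.mat 0 1) : A = B := by
  have h2 : A.mat 1 0 = B.mat 1 0 := by rw [A.mat_one_zero, B.mat_one_zero, h0]
  have h3 : A.mat 0 0 = B.mat 0 0 := by
    refine mul_right_cancel₀ (B.mat_diag_ne_zero 1) ?_
    have hA := A.det_expand
    have hB := B.det_expand
    rw [h0, h1, h2] at hA
    linear_combination hA - hB
  refine HypThree.ext ?_
  ext i j
  fin_cases i <;> fin_cases j <;> assumption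

/-- The positive quadratic form `vᴴ A⁻¹ v`. -/
noncomputable def invForm (A : HypThree) (v : Fin 2 → ℂ) : ℂ := star v ⬝ᵥ (A.mat⁻¹ *ᵥ v)

theorem invForm_eq (A : HypThree) (v : Fin 2 → ℂ) : invForm A v =
    starRingEnd ℂ (v 0) * (A.mat 1 1 * v 0 - A.mat 0 1 * v 1) +
      starRingEnd ℂ (v 1) * (A.mat 0 0 * v 1 - A.mat 1 0 * v 0) := by
  rw [invForm, A.inv_mat]
  simp [dotProduct, Matrix.mulVec, Fin.sum_univ_two]
  ring

theorem invForm_pos (A : HypThree) {v : Fin 2 → ℂ} (hv : v ≠ 0) : 0 < invForm A v :=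
  A.posDef.inv.dotProduct_mulVec_pos hv

theorem invForm_ne_zero (A : HypThree) {v : Fin 2 → ℂ} (hv : v ≠ 0) : invForm A v ≠ 0 :=
  (invForm_pos A hv).ne'

theorem ofReal_re_invForm (A : HypThree) (v : Fin 2 → ℂ) : ((invForm A v).re : ℂ) = invForm A v := by
  refine Complex.conj_eq_iff_re.mp ?_
  rw [invForm_eq]
  simp only [map_add, map_mul, map_sub, Complex.conj_conj, A.mat_one_zero, A.conj_diag]
  ring

theorem invForm_smul (A : HypThree) (a : ℂ) (v : Fin 2 → ℂ) :
    invForm A (a • v) = starRingEnd ℂ a * a * invForm A v := by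
  rw [invForm_eq, invForm_eq]
  simp
  ring

theorem unitToward_mk (A : HypThree) {v : Fin 2 → ℂ} (h : v ≠ 0) (i j : Fin 2) :
    unitToward A (Projectivization.mk ℂ v h) i j =
      2 * (v i * starRingEnd ℂ (v j)) * (invForm A v)⁻¹ - A.mat i j := by
  obtain ⟨a, ha⟩ := Projectivization.exists_smul_eq_mk_rep ℂ v h
  have ha0 : (a : ℂ) ≠ 0 := a.ne_zero
  have ha1 : starRingEnd ℂ (a : ℂ) ≠ 0 := by simp [ha0]
  have hq := invForm_ne_zero A h
  have hrep : (Projectivization.mk ℂ v h).rep = (a : ℂ) • v := ha.symm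
  rw [unitToward, ← invForm, hrep, invForm_smul]
  simp [Matrix.vecMulVec_apply]
  field_simp

/-- The Wirtinger derivative of `P` in the form `vᴴ A⁻¹ v`. -/
theorem hasWirtingerAt_invForm (A : HypThree) {P : ℂ → Fin 2 → ℂ} {w : ℂ}
    (hP : ∀ i, DifferentiableAt ℂ (fun u => P u i) w) :
    ∃ b, HasWirtingerAt (fun u => invForm A (P u))
      (starRingEnd ℂ (P w 0) * (A.mat 1 1 * deriv (fun u => P u 0) w -
          A.mat 0 1 * deriv (fun u => P u 1) w) +
        starRingEnd ℂ (P w 1) * (A.mat 0 0 * deriv (fun u => P u 1) w -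
          A.mat 1 0 * deriv (fun u => P u 0) w)) b w := by
  have h0 := (hP 0).hasDerivAt.hasWirtingerAt
  have h1 := (hP 1).hasDerivAt.hasWirtingerAt
  have hc := fun i j => HasWirtingerAt.const (w := w) (A.mat i j)
  have h := (h0.conj.mul (((hc 1 1).mul h0).sub ((hc 0 1).mul h1))).add
    (h1.conj.mul (((hc 0 0).mul h1).sub ((hc 1 0).mul h0)))
  simp only [invForm_eq]
  simp only [map_zero, zero_mul, mul_zero, zero_add] at h
  exact ⟨_, h⟩

/-- Pulled back by a map with unimodular lift `P`, the visual metric from `A` is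
`4 |dz|² / (Pᴴ A⁻¹ P)²`. -/
theorem IsUnimodularLift.visualPullback_eq {F : ℍ → ProjLine} {z : ℍ} {P : ℂ → Fin 2 → ℂ}
    (hP : IsUnimodularLift F z P) (A : HypThree) : ∀ᶠ w in 𝓝 (z : ℂ), ∀ v : ℂ,
      visualPullback A F w v = 4 / (invForm A (P w)).re ^ 2 * ‖v‖ ^ 2 := by
  filter_upwards [eventually_eventually_nhds.mpr hP] with w hw v
  have hw0 := hw.self_of_nhds
  obtain ⟨b, hq⟩ := hasWirtingerAt_invForm A hw0.1
  set a := (starRingEnd ℂ (P w 0) * (A.mat 1 1 * deriv (fun u => P u 0) w -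
          A.mat 0 1 * deriv (fun u => P u 1) w) +
        starRingEnd ℂ (P w 1) * (A.mat 0 0 * deriv (fun u => P u 1) w -
          A.mat 1 0 * deriv (fun u => P u 0) w))
  have hq0 : invForm A (P w) ≠ 0 := invForm_ne_zero A hw0.2.2.1
  have hY : ∀ i j, fderiv ℝ (fun u : ℂ => unitToward A (F (ofComplex u)) i j) w v =
      2 * ((deriv (fun u => P u i) w * v * starRingEnd ℂ (P w j) +
        P w i * starRingEnd ℂ (deriv (fun u => P u j) w * v)) * invForm A (P w) -
        P w i * starRingEnd ℂ (P w j) * (a * v + b * starRingEnd ℂ v)) / invForm A (P w) ^ 2 := by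
    intro i j
    have hev : (fun u : ℂ => unitToward A (F (ofComplex u)) i j) =ᶠ[𝓝 w]
        fun u => 2 * (P u i * starRingEnd ℂ (P u j)) * (invForm A (P u))⁻¹ - A.mat i j := by
      filter_upwards [hw] with u hu
      obtain ⟨h, h'⟩ := hu.2.2
      rw [h', unitToward_mk]
    have hi := (hw0.1 i).hasDerivAt.hasWirtingerAt
    have hj := (hw0.1 j).hasDerivAt.hasWirtingerAt.conj
    have h := ((((HasWirtingerAt.const 2).mul (hi.mul hj)).mul (hq.inv hq0)).sub
      (HasWirtingerAt.const (A.mat i j)))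
    rw [hev.fderiv_eq, h.fderiv_apply]
    simp only [map_mul, map_zero]
    field_simp
    ring
  have hwr := hw0.2.1
  have hwr' := congrArg (starRingEnd ℂ) hwr
  simp only [map_sub, map_mul, map_one] at hwr'
  -- The derivative of the denominator drops out of the determinant: it multiplies the rank one
  -- matrix `P Pᴴ`, which is orthogonal to the derivative of `P Pᴴ`.
  have hdet : Matrix.det (Matrix.of fun i j : Fin 2 =>
      fderiv ℝ (fun u : ℂ => unitToward A (F (ofComplex u)) i j) w v) =
      -(4 / invForm A (P w) ^ 2 * (v * starRingEnd ℂ v)) := by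
    rw [Matrix.det_fin_two]
    simp only [Matrix.of_apply, hY, map_mul]
    field_simp
    generalize a * v + b * starRingEnd ℂ v = t
    generalize deriv (fun u => P u 0) w = y0 at *
    generalize deriv (fun u => P u 1) w = y1 at *
    generalize invForm A (P w) = q at *
    generalize starRingEnd ℂ (P w 0) = X0 at *
    generalize starRingEnd ℂ (P w 1) = X1 at *
    generalize starRingEnd ℂ y0 = Y0 at *
    generalize starRingEnd ℂ y1 = Y1 at *
    generalize P w 0 = x0 at *
    generalize P w 1 = x1 at *
    generalize starRingEnd ℂ v = v' at *
    linear_combination (-4 * v * v' * q ^ 2 * (X0 * Y1 - X1 * Y0)) * hwr - 4 * v * v' * q ^ 2 * hwr'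
  rw [visualPullback, hdet, Complex.mul_conj, ← ofReal_re_invForm, Complex.normSq_eq_norm_sq]
  norm_cast
  ring

/-! ### The normalized Epstein point -/

/-- The function `2 / √ρ`, extended to `ℂ` through `ofComplex`. In terms of it, a metric has the
`1`-jet of `ρ |dz|²` exactly when it is `4 |dz|² / q²` with `q` of the same `1`-jet. -/
noncomputable def invSqrtDensity (ρ : ConformalMetric) (w : ℂ) : ℝ :=
  2 / √(ρ.density (ofComplex w))

theorem invSqrtDensity_pos (ρ : ConformalMetric) (w : ℂ) : 0 < invSqrtDensity ρ w :=
  div_pos two_pos (Real.sqrt_pos.mpr (ρ.density_pos _))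

theorem contDiffOn_invSqrtDensity (ρ : ConformalMetric) :
    ContDiffOn ℝ 1 (invSqrtDensity ρ) {w : ℂ | 0 < w.im} := by
  refine contDiffOn_const.div (ρ.contDiffOn.sqrt fun w _ => (ρ.density_pos _).ne') ?_
  exact fun w _ => (Real.sqrt_pos.mpr (ρ.density_pos _)).ne'

theorem differentiableAt_invSqrtDensity (ρ : ConformalMetric) (z : ℍ) :
    DifferentiableAt ℝ (invSqrtDensity ρ) z :=
  ((contDiffOn_invSqrtDensity ρ).contDiffAt
    (eventually_im_pos z)).differentiableAt one_ne_zero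

theorem density_eq (ρ : ConformalMetric) (w : ℂ) :
    ρ.density (ofComplex w) = 4 / invSqrtDensity ρ w ^ 2 := by
  have h := ρ.density_pos (ofComplex w)
  rw [invSqrtDensity, div_pow, Real.sq_sqrt h.le]
  field_simp
  norm_num

/-- The point of `ℍ³` with `A⁻¹ = [[s, b], [conj b, (1 + |b|²) / s]]`. -/
noncomputable def hypPoint (s : ℝ) (hs : 0 < s) (b : ℂ) : HypThree where
  mat := !![(((1 + ‖b‖ ^ 2) / s : ℝ) : ℂ), -b; -starRingEnd ℂ b, (s : ℂ)]
  posDef := by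
    -- the matrix is `s⁻¹ B Bᴴ` for the triangular matrix `B = [[1, -b], [0, s]]`
    have hdet : IsUnit (!![(1 : ℂ), -b; 0, s]).det := by
      rw [Matrix.det_fin_two_of]; simpa using hs.ne'
    have h := (Matrix.PosDef.one (n := Fin 2) (R := ℂ)).mul_mul_conjTranspose_same
      (Matrix.vecMul_injective_of_isUnit ((Matrix.isUnit_iff_isUnit_det _).mpr hdet))
    have hs' : (0 : ℂ) < ((s⁻¹ : ℝ) : ℂ) := by exact_mod_cast inv_pos.mpr hs
    have hs0 : (s : ℂ) ≠ 0 := by exact_mod_cast hs.ne'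
    convert h.smul hs' using 1
    have hb := (Complex.mul_conj b).trans (congrArg _ (Complex.normSq_eq_norm_sq b))
    push_cast at hb
    ext i j
    fin_cases i <;> fin_cases j <;>
      simp [Matrix.vecMul, dotProduct, Fin.sum_univ_two, hb] <;> field_simp
  det_eq := by
    have : (s : ℂ) ≠ 0 := by exact_mod_cast hs.ne'
    rw [Matrix.det_fin_two_of, neg_mul_neg, Complex.mul_conj, Complex.normSq_eq_norm_sq]
    push_cast
    field_simp
    ring

/-- The point of `ℍ³` at which Epstein's surface of `ρ` would be if the frame of the developing map
were the identity. It depends only on the `1`-jet of `ρ`. -/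
noncomputable def normalizedPoint (ρ : ConformalMetric) (z : ℍ) : HypThree :=
  hypPoint (invSqrtDensity ρ z) (invSqrtDensity_pos ρ z) (wirtinger (invSqrtDensity ρ) z)

theorem IsUnimodularLift.oneJetEq_iff {F : ℍ → ProjLine} {z : ℍ} {P : ℂ → Fin 2 → ℂ}
    (hP : IsUnimodularLift F z P) (A : HypThree) (ρ : ConformalMetric) :
    OneJetEq A F ρ z ↔ (invForm A (P z)).re = invSqrtDensity ρ z ∧
      wirtinger (fun w => (invForm A (P w)).re) z = wirtinger (invSqrtDensity ρ) z := by
  set q : ℂ → ℝ := fun w => (invForm A (P w)).re with hqdef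
  set s : ℂ → ℝ := invSqrtDensity ρ with hsdef
  have hs0 := (invSqrtDensity_pos ρ z).ne'
  have hsd : DifferentiableAt ℝ s z := differentiableAt_invSqrtDensity ρ z
  have hqpos : 0 < q z := (Complex.lt_def.mp (invForm_pos A hP.value.1)).1
  have hqd : DifferentiableAt ℝ q z := by
    obtain ⟨b, hb⟩ := hasWirtingerAt_invForm A hP.self_of_nhds.1
    exact Complex.reCLM.differentiableAt.comp _ hb.differentiableAt
  have hder : ∀ {u : ℂ → ℝ}, DifferentiableAt ℝ u z → u z ≠ 0 → ∀ c : ℝ,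
      HasFDerivAt (fun w => 4 / u w ^ 2 * c) ((-(8 / u z ^ 3) * c) • fderiv ℝ u z) (z : ℂ) := by
    intro u hu h0 c
    have h1 : HasDerivAt (fun x : ℝ => 4 / x ^ 2 * c) (-(8 / u z ^ 3) * c) (u z) := by
      have := (((hasDerivAt_const (u z) (4 : ℝ)).fun_div (hasDerivAt_pow 2 (u z))
        (pow_ne_zero 2 h0)).mul_const c)
      convert! this using 1
      field_simp
      push_cast
      ring
    exact h1.comp_hasFDerivAt _ hu.hasFDerivAt
  have hvis := hP.visualPullback_eq A
  have hfv : ∀ v : ℂ, fderiv ℝ (fun w : ℂ => visualPullback A F w v) (z : ℂ) =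
      (-(8 / q z ^ 3) * ‖v‖ ^ 2) • fderiv ℝ q z := by
    intro v
    have : (fun w : ℂ => visualPullback A F w v) =ᶠ[𝓝 (z : ℂ)] fun w => 4 / q w ^ 2 * ‖v‖ ^ 2 :=
      hvis.mono fun w hw => hw v
    rw [this.fderiv_eq, (hder hqd hqpos.ne' _).fderiv]
  have hfρ : ∀ v : ℂ, fderiv ℝ (fun w : ℂ => ρ.density (ofComplex w) * ‖v‖ ^ 2) (z : ℂ) =
      (-(8 / s z ^ 3) * ‖v‖ ^ 2) • fderiv ℝ s z := by
    intro v
    simp only [density_eq]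
    exact (hder hsd hs0 _).fderiv
  have hρz : ρ.density z = 4 / s z ^ 2 := by rw [← density_eq, ofComplex_apply]
  rw [← fderiv_eq_iff_wirtinger_eq hqd hsd, OneJetEq]
  simp only [hfv, hfρ, hvis.self_of_nhds, hρz]
  constructor
  · intro h
    obtain ⟨h1, h2⟩ := h 1
    have hqs : q z = s z := by
      have h3 : q z ^ 2 = s z ^ 2 := by
        simp only [norm_one, one_pow, mul_one] at h1
        have hq0 := hqpos.ne'
        have hsz : s z ≠ 0 := hs0
        change 4 / q z ^ 2 = 4 / s z ^ 2 at h1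
        field_simp at h1
        exact h1.symm
      exact (pow_left_inj₀ hqpos.le (invSqrtDensity_pos ρ z).le two_ne_zero).mp h3
    refine ⟨hqs, ?_⟩
    rw [hqs] at h2
    exact smul_right_injective _ (by simpa using hs0) h2
  · rintro ⟨h1, h2⟩ v
    change q z = s z at h1
    exact ⟨by rw [← h1], by rw [h1, h2]⟩

theorem wirtinger_invForm (A : HypThree) {P : ℂ → Fin 2 → ℂ} {w : ℂ}
    (hP : ∀ i, DifferentiableAt ℂ (fun u => P u i) w) :
    wirtinger (fun u => (invForm A (P u)).re) w =
      starRingEnd ℂ (P w 0) * (A.mat 1 1 * deriv (fun u => P u 0) w -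
          A.mat 0 1 * deriv (fun u => P u 1) w) +
        starRingEnd ℂ (P w 1) * (A.mat 0 0 * deriv (fun u => P u 1) w -
          A.mat 1 0 * deriv (fun u => P u 0) w) := by
  obtain ⟨b, hb⟩ := hasWirtingerAt_invForm A hP
  have hqd : DifferentiableAt ℝ (fun u => (invForm A (P u)).re) w :=
    Complex.reCLM.differentiableAt.comp _ hb.differentiableAt
  have h := hasWirtingerAt_ofReal hqd
  simp only [ofReal_re_invForm] at h
  exact (h.unique hb).1

theorem smul_mat_of_det_eq_one {N : GL (Fin 2) ℂ} (hN : N.val.det = 1) (A : HypThree) :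
    (N • A).mat = N.val * A.mat * N.valᴴ := by
  rw [smul_mat, hN]; simp

/-- The visual metric from `A`, pulled back by a map with frame `N`, has the `1`-jet of `ρ` exactly
when `A` is the image under `N` of a point that depends only on the `1`-jet of `ρ`: the Hermitian form
`Nᴴ A⁻¹ N` has in its first row the values of `Pᴴ A⁻¹ P` and of its derivative. -/
theorem IsFrame.oneJetEq_iff {F : ℍ → ProjLine} {z : ℍ} {N : GL (Fin 2) ℂ} (hN : IsFrame F z N)
    (A : HypThree) (ρ : ConformalMetric) :
    OneJetEq A F ρ z ↔ A = N • normalizedPoint ρ z := by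
  have hdet := hN.det_eq
  obtain ⟨P, hP, hNP⟩ := hN
  have hinv : (N⁻¹).val = !![deriv (fun u => P u 1) z, -deriv (fun u => P u 0) z; -P z 1, P z 0] := by
    rw [Matrix.coe_units_inv, Matrix.inv_def, hdet, Matrix.adjugate_fin_two, hNP]
    simp [frameMatrix]
  have hdet' : (N⁻¹).val.det = 1 := by
    rw [hinv, Matrix.det_fin_two_of]
    have := hP.self_of_nhds.2.1
    linear_combination this
  rw [hP.oneJetEq_iff, wirtinger_invForm A hP.self_of_nhds.1, ← inv_smul_eq_iff]
  have hm := smul_mat_of_det_eq_one hdet' A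
  have h11 : (N⁻¹ • A).mat 1 1 = ((invForm A (P z)).re : ℂ) := by
    rw [hm, hinv, ofReal_re_invForm, invForm_eq]
    simp [Matrix.mul_apply, Matrix.vecMul, dotProduct, Fin.sum_univ_two]
    ring
  have h01 : (N⁻¹ • A).mat 0 1 = -(starRingEnd ℂ (P z 0) * (A.mat 1 1 * deriv (fun u => P u 0) z -
          A.mat 0 1 * deriv (fun u => P u 1) z) +
        starRingEnd ℂ (P z 1) * (A.mat 0 0 * deriv (fun u => P u 1) z -
          A.mat 1 0 * deriv (fun u => P u 0) z)) := by
    rw [hm, hinv]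
    simp [Matrix.mul_apply, Matrix.vecMul, dotProduct, Fin.sum_univ_two]
    ring
  have hC1 : (normalizedPoint ρ z).mat 1 1 = (invSqrtDensity ρ z : ℂ) := rfl
  have hC0 : (normalizedPoint ρ z).mat 0 1 = -wirtinger (invSqrtDensity ρ) z := rfl
  constructor
  · rintro ⟨h1, h2⟩
    refine HypThree.ext_col ?_ ?_
    · rw [h11, hC1, h1]
    · rw [h01, hC0, h2]
  · intro h
    rw [h, hC1] at h11
    rw [h, hC0] at h01
    exact ⟨by exact_mod_cast h11.symm, (neg_injective h01).symm⟩

end EP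

namespace EP

/-! ### Existence, uniqueness and continuity of Epstein's surface -/

theorem continuousAt_wirtinger_invSqrtDensity (ρ : ConformalMetric) (z : ℍ) :
    ContinuousAt (wirtinger (invSqrtDensity ρ)) z := by
  have h : ContinuousAt (fderiv ℝ (invSqrtDensity ρ)) z :=
    (((contDiffOn_invSqrtDensity ρ).contDiffAt (eventually_im_pos z)).fderiv_right
      (m := 0) le_rfl).continuousAt
  have h1 := fun v : ℂ => Complex.continuous_ofReal.continuousAt.comp (h.clm_apply
    (continuousAt_const (y := v)))
  exact continuousAt_const.mul ((h1 1).sub (continuousAt_const.mul (h1 Complex.I)))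

theorem continuous_normalizedPoint_mat (ρ : ConformalMetric) :
    Continuous fun z => (normalizedPoint ρ z).mat := by
  refine continuous_iff_continuousAt.mpr fun z => ?_
  have hb : ContinuousAt (fun z : ℍ => wirtinger (invSqrtDensity ρ) z) z :=
    (continuousAt_wirtinger_invSqrtDensity ρ z).comp continuous_coe.continuousAt
  have hs : ContinuousAt (fun z : ℍ => invSqrtDensity ρ z) z :=
    (differentiableAt_invSqrtDensity ρ z).continuousAt.comp (f := fun z : ℍ => (z : ℂ))
      continuous_coe.continuousAt
  refine continuousAt_pi.mpr fun i => continuousAt_pi.mpr fun j => ?_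
  have h00 : ContinuousAt (fun z : ℍ => (((1 + ‖wirtinger (invSqrtDensity ρ) z‖ ^ 2) /
      invSqrtDensity ρ z : ℝ) : ℂ)) z :=
    Complex.continuous_ofReal.continuousAt.comp
      ((continuousAt_const.add (hb.norm.pow 2)).div hs (invSqrtDensity_pos ρ z).ne')
  fin_cases i <;> fin_cases j
  · exact h00
  · exact hb.neg
  · exact (Complex.continuous_conj.continuousAt.comp hb).neg
  · exact Complex.continuous_ofReal.continuousAt.comp hs

theorem IsUnimodularLift.eventually_nhds_upperHalfPlane {F : ℍ → ProjLine} {z : ℍ}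
    {P : ℂ → Fin 2 → ℂ} (hP : IsUnimodularLift F z P) : ∀ᶠ w in 𝓝 z, IsUnimodularLift F w P := by
  filter_upwards [(continuous_coe.tendsto z).eventually hP.eventually_nhds] with w hw
  rwa [ofComplex_apply] at hw

/-- Continuity is automatic for a map that satisfies the `1`-jet condition of Epstein's surface. -/
theorem continuous_of_oneJetEq {F : ℍ → ProjLine} (hF : ∀ z, ∃ P, IsUnimodularLift F z P)
    {ρ : ConformalMetric} {E : ℍ → HypThree} (hE : ∀ z, OneJetEq (E z) F ρ z) : Continuous E := by
  refine continuous_iff_continuousAt.mpr fun z => ?_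
  obtain ⟨P, hP⟩ := hF z
  have hind : Topology.IsInducing HypThree.mat := ⟨rfl⟩
  rw [hind.continuousAt_iff]
  have hev : HypThree.mat ∘ E =ᶠ[𝓝 z]
      fun w => frameMatrix P w * (normalizedPoint ρ w).mat * (frameMatrix P w)ᴴ := by
    filter_upwards [hP.eventually_nhds_upperHalfPlane] with w hw
    obtain ⟨N, hNv, hN⟩ := hw.exists_frame
    have := (hN.oneJetEq_iff (E w) ρ).mp (hE w)
    rw [Function.comp_apply, this, smul_mat_of_det_eq_one hN.det_eq, hNv]
  refine ContinuousAt.congr ?_ hev.symm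
  have hc : ContinuousAt (fun w : ℍ => (w : ℂ)) z := continuous_coe.continuousAt
  have hfr : ContinuousAt (fun w : ℍ => frameMatrix P w) z := by
    refine continuousAt_pi.mpr fun i => continuousAt_pi.mpr fun j => ?_
    have h0 := fun i => (hP.analyticAt i).continuousAt.comp (f := fun w : ℍ => (w : ℂ)) hc
    have h1 := fun i => (hP.analyticAt i).deriv.continuousAt.comp (f := fun w : ℍ => (w : ℂ)) hc
    fin_cases i <;> fin_cases j
    exacts [h0 0, h1 0, h0 1, h1 1]
  exact (hfr.mul (continuous_normalizedPoint_mat ρ).continuousAt).mul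
    ((continuous_id.matrix_conjTranspose.continuousAt).comp hfr)

theorem isEpsteinSurface_iff {F : ℍ → ProjLine} (hF : ∀ z, ∃ P, IsUnimodularLift F z P)
    {ρ : ConformalMetric} {E : ℍ → HypThree} {N : ℍ → GL (Fin 2) ℂ} (hN : ∀ z, IsFrame F z (N z)) :
    IsEpsteinSurface ρ F E ↔ ∀ z, E z = N z • normalizedPoint ρ z := by
  constructor
  · exact fun h z => ((hN z).oneJetEq_iff _ _).mp (h.2 z)
  · intro h
    have h' : ∀ z, OneJetEq (E z) F ρ z := fun z => ((hN z).oneJetEq_iff _ _).mpr (h z)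
    exact ⟨continuous_of_oneJetEq hF h', h'⟩

/-! ### Canonical lifts -/

/-- The diagonal matrix with entries `1, √2`. -/
noncomputable def diagSqrtTwo : GL (Fin 2) ℂ :=
  Matrix.GeneralLinearGroup.mkOfDetNeZero !![1, 0; 0, ((√2 : ℝ) : ℂ)] (by simp)

theorem sqrt_two_sq : ((√2 : ℝ) : ℂ) ^ 2 = 2 := by
  rw [← Complex.ofReal_pow, Real.sq_sqrt two_pos.le]; norm_num

theorem sqrt_two_ne_zero : ((√2 : ℝ) : ℂ) ≠ 0 := by simp

theorem eventually_eq_of_hasDerivAt_zero {g : ℂ → ℂ} {z : ℂ}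
    (h : ∀ᶠ w in 𝓝 z, HasDerivAt g 0 w) : ∀ᶠ w in 𝓝 z, g w = g z := by
  obtain ⟨r, hr, hball⟩ := Metric.eventually_nhds_iff_ball.mp h
  filter_upwards [Metric.ball_mem_nhds z hr] with w hw
  exact Metric.isOpen_ball.is_const_of_deriv_eq_zero (convex_ball z r).isPreconnected
    (fun u hu => (hball u hu).differentiableAt.differentiableWithinAt)
    (fun u hu => (hball u hu).deriv) hw (Metric.mem_ball_self hr)

theorem mk_smul_basePoint (g : GL (Fin 2) ℂ) {v : Fin 2 → ℂ} (hv : ∀ i, v i = g.val i 0) :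
    ∃ h : v ≠ 0, (Matrix.ProjGenLinGroup.mk g : PGL(2, ℂ)) • basePoint =
      Projectivization.mk ℂ v h := by
  have hgv : g • (![1, 0] : Fin 2 → ℂ) = v := by
    ext i
    change (g.val *ᵥ ![1, 0]) i = _
    rw [hv]
    simp [Matrix.mulVec, dotProduct, Fin.sum_univ_two]
  have h10 : (![1, 0] : Fin 2 → ℂ) ≠ 0 := fun h => one_ne_zero (congrFun h 0)
  subst hgv
  exact ⟨(smul_ne_zero_iff_ne g).mpr h10, rfl⟩

/-- A map `M` to `GL(2, ℂ)` with locally constant determinant, whose first column is a lift of `F`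
and satisfies `p' = q / √2 - k p` for the second column `q`, determines a frame of `F`: the Wronskian
of `p` is `det M / √2`. -/
theorem exists_isFrame_of_columns {F : ℍ → ProjLine} {z : ℍ} {M : ℂ → GL (Fin 2) ℂ} {k : ℂ → ℂ}
    (hM : ∀ᶠ w in 𝓝 (z : ℂ),
      (∀ i, HasDerivAt (fun u => (M u).val i 0) ((M w).val i 1 / (√2 : ℝ) - k w * (M w).val i 0) w) ∧
      HasDerivAt (fun u => (M u).val.det) 0 w ∧
      (Matrix.ProjGenLinGroup.mk (M w) : PGL(2, ℂ)) • basePoint = F (ofComplex w)) :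
    ∃ N, IsFrame F z N ∧ ∃ κ : ℂ, κ ≠ 0 ∧
      N.val = κ • ((M z).val * !![1, -k z; 0, 1 / ((√2 : ℝ) : ℂ)]) := by
  have hs := sqrt_two_ne_zero
  have hdet := eventually_eq_of_hasDerivAt_zero (hM.mono fun w hw => hw.2.1)
  have hD : (M z).val.det / (√2 : ℝ) ≠ 0 := div_ne_zero (M z).det.ne_zero hs
  obtain ⟨N, κ, hκ, hN, hNv⟩ := exists_isFrame_of_wronskian_const (F := F) (z := z)
    (P := fun w i => (M w).val i 0) hD (by
      filter_upwards [hM, hdet] with w hw hdw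
      refine ⟨fun i => (hw.1 i).differentiableAt, ?_, ?_⟩
      · rw [(hw.1 0).deriv, (hw.1 1).deriv, ← hdw, Matrix.det_fin_two]
        ring
      · rw [← hw.2.2]
        exact mk_smul_basePoint (M w) fun i => rfl)
  refine ⟨N, hN, κ, hκ, ?_⟩
  rw [hNv]
  congr 1
  have hz := hM.self_of_nhds.1
  ext i j
  fin_cases i <;> fin_cases j <;>
    simp [frameMatrix, Matrix.mul_apply, Fin.sum_univ_two, (hz _).deriv] <;> ring

theorem IsCanonicalLift.eq_mk {F : ℍ → ProjLine} {L : ℍ → PGL(2, ℂ)} (hL : IsCanonicalLift F L)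
    {z : ℍ} {N : GL (Fin 2) ℂ} (hN : IsFrame F z N) :
    L z = Matrix.ProjGenLinGroup.mk N * Matrix.ProjGenLinGroup.mk diagSqrtTwo := by
  have hs := sqrt_two_ne_zero
  obtain ⟨M, α, hM⟩ := hL z
  have hcol : ∀ᶠ w in 𝓝 (z : ℂ), (∀ i, HasDerivAt (fun u => (M u).val i 0)
      ((M w).val i 1 / (√2 : ℝ)) w) ∧
      ∀ i, HasDerivAt (fun u => (M u).val i 1) (α w * (M w).val i 0 / (√2 : ℝ)) w := by
    filter_upwards [hM] with w hw
    refine ⟨fun i => ?_, fun i => ?_⟩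
    · convert! hw.1 i 0 using 1
      simp [tripletE, tripletF, Matrix.mul_apply, Fin.sum_univ_two]
      ring
    · convert! hw.1 i 1 using 1
      simp [tripletE, tripletF, Matrix.mul_apply, Fin.sum_univ_two]
      ring
  obtain ⟨N', hN', κ, hκ, hv⟩ := exists_isFrame_of_columns (F := F) (z := z) (M := M)
    (k := fun _ => 0) (by
      filter_upwards [hM, hcol] with w hw hc
      refine ⟨fun i => by simpa using hc.1 i, ?_, by rw [hw.2.1, hw.2.2]⟩
      simp only [Matrix.det_fin_two]
      have h := ((hc.1 0).fun_mul (hc.2 1)).fun_sub ((hc.2 0).fun_mul (hc.1 1))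
      convert! h using 1
      ring)
  rw [hN.mk_eq hN', ← map_mul]
  have hz : L z = Matrix.ProjGenLinGroup.mk (M z) := by
    have := hM.self_of_nhds.2.1
    rw [ofComplex_apply] at this
    exact this.symm
  rw [hz]
  refine mk_eq_mk_of_val_eq_smul hκ ?_
  rw [Units.val_mul, hv, Matrix.smul_mul, Matrix.mul_assoc]
  congr 1
  ext i j
  fin_cases i <;> fin_cases j <;>
    simp [diagSqrtTwo, Matrix.mul_apply, Fin.sum_univ_two]

/-- For a unimodular lift `P`, the matrix with columns `P` and `√2 P'` is a canonical lift: the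
derivative of the Wronskian vanishes, so that `P''` is a multiple of `P`. -/
theorem exists_isCanonicalLift {F : ℍ → ProjLine} (hF : ∀ z, ∃ P, IsUnimodularLift F z P) :
    ∃ L, IsCanonicalLift F L := by
  have hs := sqrt_two_ne_zero
  have hfr : ∀ z, ∃ N, IsFrame F z N := fun z => by
    obtain ⟨P, hP⟩ := hF z
    exact hP.exists_isFrame
  choose N hN using hfr
  refine ⟨fun z => Matrix.ProjGenLinGroup.mk (N z * diagSqrtTwo), fun z => ?_⟩
  obtain ⟨P, hP⟩ := hF z
  have hM : ∀ w, ∃ M : GL (Fin 2) ℂ, (frameMatrix P w).det = 1 → M.val = frameMatrix P w := by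
    intro w
    by_cases h : (frameMatrix P w).det = 1
    · exact ⟨Matrix.GeneralLinearGroup.mkOfDetNeZero (frameMatrix P w)
        (by rw [h]; exact one_ne_zero), fun _ => rfl⟩
    · exact ⟨1, fun h' => absurd h' h⟩
  choose M hM using hM
  have hval : ∀ w, (frameMatrix P w).det = 1 → ∀ i, (M w * diagSqrtTwo).val i 0 = P w i ∧
      (M w * diagSqrtTwo).val i 1 = deriv (fun u => P u i) w * (√2 : ℝ) := by
    intro w hw i
    rw [Units.val_mul, hM w hw]
    fin_cases i <;> simp [diagSqrtTwo, frameMatrix]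
  refine ⟨fun w => M w * diagSqrtTwo, fun w => 2 * (deriv (deriv fun u => P u 0) w *
    deriv (fun u => P u 1) w - deriv (deriv fun u => P u 1) w * deriv (fun u => P u 0) w), ?_⟩
  filter_upwards [eventually_eventually_nhds.mpr hP, hP.eventually_nhds, eventually_im_pos z]
    with w hw hPw him
  have hcoe : ((ofComplex w : ℍ) : ℂ) = w := by rw [ofComplex_apply_of_im_pos him]
  have han : ∀ i, AnalyticAt ℂ (fun u => P u i) w := fun i =>
    Complex.analyticAt_iff_eventually_differentiableAt.mpr (hw.mono fun _ h => h.1 i)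
  have hd1 := fun i => (han i).differentiableAt.hasDerivAt
  have hd2 := fun i => (han i).deriv.differentiableAt.hasDerivAt
  have hdet : ∀ᶠ u in 𝓝 w, (frameMatrix P u).det = 1 :=
    hw.mono fun u hu => by rw [frameMatrix_det]; exact hu.2.1
  have hwr := hw.self_of_nhds.2.1
  have hwr' : P w 0 * deriv (deriv fun u => P u 1) w - P w 1 * deriv (deriv fun u => P u 0) w = 0 := by
    have h1 := ((hd1 0).fun_mul (hd2 1)).fun_sub ((hd1 1).fun_mul (hd2 0))
    have h2 : HasDerivAt (fun u => P u 0 * deriv (fun u => P u 1) u -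
        P u 1 * deriv (fun u => P u 0) u) 0 w :=
      (hasDerivAt_const w (1 : ℂ)).congr_of_eventuallyEq (hw.mono fun u hu => hu.2.1)
    have h3 := h1.unique h2
    linear_combination h3
  have hP2 : ∀ i, deriv (deriv fun u => P u i) w = (deriv (deriv fun u => P u 0) w *
    deriv (fun u => P u 1) w - deriv (deriv fun u => P u 1) w * deriv (fun u => P u 0) w) *
      P w i := by
    intro i
    fin_cases i
    · simp only [Fin.zero_eta]
      linear_combination (-deriv (deriv fun u => P u 0) w) * hwr -
        (-deriv (fun u => P u 0) w) * hwr'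
    · simp only [Fin.mk_one]
      linear_combination (-deriv (deriv fun u => P u 1) w) * hwr -
        (-deriv (fun u => P u 1) w) * hwr'
  have hmk : (Matrix.ProjGenLinGroup.mk (M w * diagSqrtTwo) : PGL(2, ℂ)) =
      Matrix.ProjGenLinGroup.mk (N (ofComplex w) * diagSqrtTwo) := by
    rw [map_mul, map_mul]
    congr 1
    exact IsFrame.mk_eq ⟨P, hPw, by rw [hcoe, hM w hdet.self_of_nhds]⟩ (hN _)
  refine ⟨fun i j => ?_, ?_, ?_⟩
  · have h0 : (fun u => (M u * diagSqrtTwo).val i 0) =ᶠ[𝓝 w] fun u => P u i :=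
      hdet.mono fun u hu => (hval u hu i).1
    have h1 : (fun u => (M u * diagSqrtTwo).val i 1) =ᶠ[𝓝 w]
        fun u => deriv (fun u => P u i) u * (√2 : ℝ) := hdet.mono fun u hu => (hval u hu i).2
    obtain ⟨e0, e1⟩ := hval w hdet.self_of_nhds i
    rw [Matrix.mul_apply, Fin.sum_univ_two, e0, e1]
    fin_cases j
    · refine HasDerivAt.congr_of_eventuallyEq ?_ h0
      refine (hd1 i).congr_deriv ?_
      simp [tripletE, tripletF]
    · refine HasDerivAt.congr_of_eventuallyEq ?_ h1
      refine ((hd2 i).mul_const _).congr_deriv ?_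
      rw [hP2 i]
      simp [tripletE, tripletF]
      field_simp
      rw [sqrt_two_sq]
  · exact hmk
  · obtain ⟨_, h⟩ := mk_smul_basePoint (M w * diagSqrtTwo) (v := P w)
      fun i => (hval w hdet.self_of_nhds i).1.symm
    rw [← hmk, h]
    exact hw.self_of_nhds.2.2.2.symm

end EP

namespace EP

/-! ### Cartan involutions -/

theorem HypThree.isUnit_det (A : HypThree) : IsUnit A.mat.det := by
  rw [A.det_eq]; exact isUnit_one

theorem cartanInvolution_eq_iff (A : HypThree) (X Z : Matrix (Fin 2) (Fin 2) ℂ) :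
    cartanInvolution A X = Z ↔ A.mat * Xᴴ = -(Z * A.mat) := by
  rw [cartanInvolution]
  constructor
  · rintro rfl
    rw [Matrix.neg_mul, neg_neg, Matrix.nonsing_inv_mul_cancel_right _ _ A.isUnit_det]
  · intro h
    rw [h, Matrix.neg_mul, neg_neg, Matrix.mul_nonsing_inv_cancel_right _ _ A.isUnit_det]

theorem cartanInvolution_smul (g : GL (Fin 2) ℂ) (A : HypThree) (X : Matrix (Fin 2) (Fin 2) ℂ) :
    cartanInvolution (g • A) (g.val * X * g.val⁻¹) = g.val * cartanInvolution A X * g.val⁻¹ := by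
  have hg : IsUnit g.val.det := (Matrix.isUnit_iff_isUnit_det _).mp g.isUnit
  rw [cartanInvolution_eq_iff]
  have h := (cartanInvolution_eq_iff A X _).mp rfl
  have h1 : g.valᴴ * (g.val⁻¹)ᴴ = 1 := by
    rw [← Matrix.conjTranspose_mul, Matrix.nonsing_inv_mul _ hg, Matrix.conjTranspose_one]
  have h2 : g.val⁻¹ * g.val = 1 := Matrix.nonsing_inv_mul _ hg
  rw [smul_mat, Matrix.smul_mul, Matrix.mul_smul, ← smul_neg]
  congr 1
  calc g.val * A.mat * g.valᴴ * (g.val * X * g.val⁻¹)ᴴ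
      = g.val * A.mat * (g.valᴴ * (g.val⁻¹)ᴴ) * Xᴴ * g.valᴴ := by
        simp only [Matrix.conjTranspose_mul, Matrix.mul_assoc]
    _ = g.val * (A.mat * Xᴴ) * g.valᴴ := by rw [h1]; simp only [Matrix.mul_assoc, Matrix.mul_one]
    _ = -(g.val * cartanInvolution A X * (g.val⁻¹ * g.val) * A.mat * g.valᴴ) := by
        rw [h, h2]; simp only [Matrix.mul_assoc, Matrix.mul_one, Matrix.mul_neg, Matrix.neg_mul]
    _ = _ := by simp only [Matrix.mul_assoc]

/-- The diagonal point of `ℍ³` whose Cartan involution is the one of the Fuchsian bundle. -/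
noncomputable def fuchsianPoint (z : ℍ) : HypThree :=
  hypPoint (√2 * z.im) (mul_pos (by positivity) z.im_pos) 0

theorem cartanInvolution_eq_fuchsianInvolution_iff (A : HypThree) (z : ℍ) :
    (∀ X : Matrix (Fin 2) (Fin 2) ℂ, X.trace = 0 →
      cartanInvolution A X = fuchsianInvolution z X) ↔ A = fuchsianPoint z := by
  have hy : (z.im : ℂ) ≠ 0 := by exact_mod_cast z.im_pos.ne'
  have hs := sqrt_two_ne_zero
  have hs2 := sqrt_two_sq
  have hH : (hypCoeff z : ℂ) = 1 / (2 * (z.im : ℂ) ^ 2) := by rw [hypCoeff]; push_cast; rfl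
  constructor
  · intro h
    -- testing on `E₁₂` alone forces `A` to be diagonal with the right quotient of entries
    have h1 := (cartanInvolution_eq_iff _ _ _).mp (h !![0, 1; 0, 0] (by simp [Matrix.trace_fin_two]))
    have e00 := congrFun (congrFun h1 0) 0
    have e10 := congrFun (congrFun h1 1) 0
    simp [fuchsianInvolution, hH, Matrix.mul_apply, Matrix.vecMul, dotProduct,
      Fin.sum_univ_two] at e00 e10
    refine HypThree.ext_col ?_ ?_
    · have hd := A.det_expand
      rw [e00] at hd
      have hpos : 0 < A.mat 1 1 := A.posDef.diag_pos
      obtain ⟨a, ha⟩ : ∃ a : ℝ, A.mat 1 1 = a := ⟨(A.mat 1 1).re, by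
        rw [Complex.conj_eq_iff_re.mp (A.conj_diag 1)]⟩
      have hsq : A.mat 1 1 ^ 2 = ((√2 : ℝ) : ℂ) ^ 2 * z.im ^ 2 := by
        rw [hs2]
        linear_combination A.mat 1 1 * e10 + 2 * (z.im : ℂ) ^ 2 * hd
      rw [ha] at hsq hpos
      have hsq' : a ^ 2 = (√2 * z.im) ^ 2 := by rw [mul_pow]; exact_mod_cast hsq
      have ha0 : 0 ≤ a := by exact_mod_cast hpos.le
      have := (pow_left_inj₀ ha0 (by have := z.im_pos; positivity) two_ne_zero).mp hsq'
      rw [ha, this]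
      rfl
    · rw [e00]
      simp [fuchsianPoint, hypPoint]
  · rintro rfl X -
    rw [cartanInvolution_eq_iff]
    ext i j
    fin_cases i <;> fin_cases j <;>
      simp [fuchsianPoint, hypPoint, fuchsianInvolution, hH, Matrix.mul_apply,
        Fin.sum_univ_two] <;> field_simp <;> simp [hs2] <;> ring

theorem cartanInvolution_conj_iff (A : HypThree) (g : GL (Fin 2) ℂ) (z : ℍ) :
    (∀ X : Matrix (Fin 2) (Fin 2) ℂ, X.trace = 0 →
      cartanInvolution A (g.val * X * g.val⁻¹) = g.val * fuchsianInvolution z X * g.val⁻¹) ↔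
      A = g • fuchsianPoint z := by
  have hg : IsUnit g.val.det := (Matrix.isUnit_iff_isUnit_det _).mp g.isUnit
  rw [← inv_smul_eq_iff, ← cartanInvolution_eq_fuchsianInvolution_iff]
  refine forall₂_congr fun X _ => ?_
  have h := cartanInvolution_smul g (g⁻¹ • A) X
  rw [smul_inv_smul] at h
  rw [h]
  constructor
  · intro h
    have h' := congrArg (fun Y => g.val⁻¹ * Y * g.val) h
    simpa only [Matrix.mul_assoc, Matrix.nonsing_inv_mul _ hg, Matrix.mul_one,
      Matrix.nonsing_inv_mul_cancel_left _ _ hg] using h'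
  · intro h; rw [h]

/-! ### The Fuchsian surface -/

theorem hasFDerivAt_im (w : ℂ) : HasFDerivAt (fun u : ℂ => u.im) Complex.imCLM w :=
  Complex.imCLM.hasFDerivAt

theorem wirtinger_log_hypCoeff (z : ℍ) :
    wirtinger (fun u => Real.log (hypCoeff u)) z = Complex.I / z.im := by
  have hy := z.im_pos.ne'
  have h1 : HasDerivAt (fun y : ℝ => Real.log (1 / (2 * y ^ 2))) (-2 / z.im) z.im := by
    have h2 : HasDerivAt (fun y : ℝ => 1 / (2 * y ^ 2)) (-1 / z.im ^ 3) z.im := by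
      have := (hasDerivAt_const z.im (1 : ℝ)).fun_div ((hasDerivAt_pow 2 z.im).const_mul 2)
        (by positivity)
      convert! this using 1
      field_simp
      push_cast
      ring
    have := h2.log (by positivity)
    convert! this using 1
    field_simp
  have h2 := h1.comp_hasFDerivAt (z : ℂ) (hasFDerivAt_im z)
  have h3 : fderiv ℝ (fun u => Real.log (hypCoeff u)) (z : ℂ) = (-2 / z.im) • Complex.imCLM :=
    h2.fderiv
  rw [wirtinger, h3]
  simp
  ring

theorem invSqrtDensity_hyperbolicMetric_jet (z : ℍ) :
    invSqrtDensity hyperbolicMetric z = 2 * z.im ∧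
      wirtinger (invSqrtDensity hyperbolicMetric) z = -Complex.I := by
  have h : invSqrtDensity hyperbolicMetric =ᶠ[𝓝 (z : ℂ)] fun u => 2 * u.im := by
    filter_upwards [eventually_im_pos z] with w hw
    rw [invSqrtDensity, ofComplex_apply_of_im_pos hw]
    change 2 / √(1 / w.im ^ 2) = _
    rw [Real.sqrt_div zero_le_one, Real.sqrt_one, Real.sqrt_sq hw.le]
    field_simp
  refine ⟨h.self_of_nhds, ?_⟩
  rw [wirtinger, h.fderiv_eq, ((hasFDerivAt_im z).const_mul 2).fderiv]
  simp
  ring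

/-- The triangular matrix that relates the frame of the Fuchsian oper to a flat trivialization of
its bundle. -/
noncomputable def fuchsianGauge (z : ℍ) : GL (Fin 2) ℂ :=
  Matrix.GeneralLinearGroup.mkOfDetNeZero
    !![1, -(Complex.I / (2 * z.im)); 0, 1 / ((√2 : ℝ) : ℂ)] (by simp)

theorem fuchsianGauge_smul (z : ℍ) :
    fuchsianGauge z • normalizedPoint hyperbolicMetric z = fuchsianPoint z := by
  have hy : (z.im : ℂ) ≠ 0 := by exact_mod_cast z.im_pos.ne'
  have hs := sqrt_two_ne_zero
  have hs2 := sqrt_two_sq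
  obtain ⟨h1, h2⟩ := invSqrtDensity_hyperbolicMetric_jet z
  have hval : (fuchsianGauge z).val = !![1, -(Complex.I / (2 * z.im)); 0, 1 / ((√2 : ℝ) : ℂ)] := rfl
  have hdet : ‖(fuchsianGauge z).val.det‖⁻¹ = √2 := by
    rw [hval, Matrix.det_fin_two_of]; simp
  refine HypThree.ext_col ?_ ?_
  · rw [smul_mat, hdet, hval]
    simp [normalizedPoint, fuchsianPoint, hypPoint, h1, h2, Matrix.vecMul, dotProduct,
      Fin.sum_univ_two]
    field_simp
    rw [hs2]
  · rw [smul_mat, hdet, hval]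
    simp [normalizedPoint, fuchsianPoint, hypPoint, h1, h2, Matrix.vecMul, dotProduct,
      Fin.sum_univ_two]
    field_simp
    ring

theorem fuchsianForm_eq (z : ℍ) (v : ℂ) : fuchsianForm z v =
    !![-(Complex.I / (2 * z.im)) * v, starRingEnd ℂ v / (2 * z.im ^ 2) / (√2 : ℝ);
      v / (√2 : ℝ), Complex.I / (2 * z.im) * v] := by
  rw [fuchsianForm, wirtinger_log_hypCoeff, hypCoeff]
  ext i j
  fin_cases i <;> fin_cases j <;> simp [tripletE, tripletF, tripletH] <;> ring

theorem exists_isUnimodularLift_fuchsianDev (z : ℍ) : ∃ P, IsUnimodularLift fuchsianDev z P := by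
  refine ⟨fun w => ![Complex.I * w, Complex.I], ?_⟩
  filter_upwards [eventually_im_pos z] with w hw
  refine ⟨fun i => ?_, ?_, ?_⟩
  · fin_cases i
    · simp; fun_prop
    · simp
  · simp
  · have h : (![Complex.I * w, Complex.I] : Fin 2 → ℂ) ≠ 0 :=
      fun h => Complex.I_ne_zero (congrFun h 1)
    refine ⟨h, ?_⟩
    rw [fuchsianDev, Projectivization.mk_eq_mk_iff', ofComplex_apply_of_im_pos hw]
    refine ⟨-Complex.I, ?_⟩
    ext i
    fin_cases i <;> simp [← mul_assoc]

/-- Any flat trivialization with the right developing map puts the Fuchsian surface at the Epstein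
point of the hyperbolic metric. -/
theorem IsFuchsianSurface.eq_smul {S : ℍ → HypThree} (hS : IsFuchsianSurface S) {z : ℍ}
    {N : GL (Fin 2) ℂ} (hN : IsFrame fuchsianDev z N) :
    S z = N • normalizedPoint hyperbolicMetric z := by
  obtain ⟨M, hM, hbase, hΘ⟩ := hS
  have hs := sqrt_two_ne_zero
  have hcol : ∀ w : ℍ, ∀ i,
      HasWirtingerAt (fun u : ℂ => (M (ofComplex u)).val i 0)
        ((M w).val i 1 / (√2 : ℝ) - Complex.I / (2 * w.im) * (M w).val i 0) 0 w ∧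
      HasWirtingerAt (fun u : ℂ => (M (ofComplex u)).val i 1)
        (Complex.I / (2 * w.im) * (M w).val i 1) ((M w).val i 0 / (2 * w.im ^ 2) / (√2 : ℝ)) w := by
    intro w i
    constructor
    · refine .of_fderiv (hM w i 0).1 fun v => ?_
      rw [(hM w i 0).2, fuchsianForm_eq]
      simp [Matrix.mul_apply, Fin.sum_univ_two]
      ring
    · refine .of_fderiv (hM w i 1).1 fun v => ?_
      rw [(hM w i 1).2, fuchsianForm_eq]
      simp [Matrix.mul_apply, Fin.sum_univ_two]
      ring
  obtain ⟨N', hN', κ, hκ, hv⟩ := exists_isFrame_of_columns (F := fuchsianDev) (z := z)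
    (M := fun w => M (ofComplex w)) (k := fun w => Complex.I / (2 * w.im)) (by
      filter_upwards [eventually_im_pos z] with w him
      obtain ⟨u, rfl⟩ : ∃ u : ℍ, (u : ℂ) = w := ⟨⟨w, him⟩, rfl⟩
      rw [ofComplex_apply]
      refine ⟨fun i => (hcol u i).1.hasDerivAt, ?_, hbase u⟩
      refine HasWirtingerAt.hasDerivAt ?_
      simp only [Matrix.det_fin_two]
      have h := ((hcol u 0).1.mul (hcol u 1).2).sub ((hcol u 0).2.mul (hcol u 1).1)
      simp only [ofComplex_apply] at h
      convert h using 1 <;> ring)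
  have hmk : (Matrix.ProjGenLinGroup.mk (M z * fuchsianGauge z) : PGL(2, ℂ)) =
      Matrix.ProjGenLinGroup.mk N := by
    rw [hN.mk_eq hN']
    refine mk_eq_mk_of_val_eq_smul hκ ?_
    rw [hv, ofComplex_apply]
    rfl
  rw [(cartanInvolution_conj_iff (S z) (M z) z).mp (hΘ z), ← fuchsianGauge_smul, smul_smul,
    ← mk_smul_hypThree, hmk, mk_smul_hypThree]

theorem hasWirtingerAt_inv_im (z : ℍ) : HasWirtingerAt (fun u : ℂ => ((u.im : ℝ) : ℂ)⁻¹)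
    (Complex.I / (2 * z.im ^ 2)) (-Complex.I / (2 * z.im ^ 2)) z := by
  have hy : (z.im : ℂ) ≠ 0 := by exact_mod_cast z.im_pos.ne'
  have h1 : HasWirtingerAt (fun u : ℂ => ((u.im : ℝ) : ℂ)) (-Complex.I / 2) (Complex.I / 2) z := by
    have h := hasWirtingerAt_ofReal (hasFDerivAt_im z).differentiableAt
    have hw : wirtinger (fun u => u.im) z = -Complex.I / 2 := by
      rw [wirtinger, (hasFDerivAt_im z).fderiv]; simp; ring
    rw [hw] at h
    convert h using 1
    simp [Complex.conj_ofNat]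
  have h := h1.inv hy
  convert h using 1 <;> simp <;> field_simp

theorem exists_isFuchsianSurface : ∃ S, IsFuchsianSurface S := by
  have hs := sqrt_two_ne_zero
  have hs2 := sqrt_two_sq
  -- the columns are `p = (z, 1)` and `q = √2 (p' + (i / 2y) p)`
  set m : ℂ → Matrix (Fin 2) (Fin 2) ℂ := fun w =>
    !![w, (√2 : ℝ) * (1 + Complex.I / 2 * (w.im : ℂ)⁻¹ * w);
      1, (√2 : ℝ) * (Complex.I / 2 * (w.im : ℂ)⁻¹)] with hm
  have hdet : ∀ w, (m w).det ≠ 0 := by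
    intro w
    have : (m w).det = -(√2 : ℝ) := by rw [hm, Matrix.det_fin_two_of]; ring
    rw [this]
    exact neg_ne_zero.mpr hs
  set M : ℍ → GL (Fin 2) ℂ := fun z => Matrix.GeneralLinearGroup.mkOfDetNeZero (m z) (hdet z)
  refine ⟨fun z => M z • fuchsianPoint z, M, fun z i j => ?_, fun z => ?_, fun z =>
    (cartanInvolution_conj_iff _ _ z).mpr rfl⟩
  · have hy : (z.im : ℂ) ≠ 0 := by exact_mod_cast z.im_pos.ne'
    have hev : (fun w : ℂ => (M (ofComplex w)).val i j) =ᶠ[𝓝 (z : ℂ)] fun w => m w i j := by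
      filter_upwards [eventually_im_pos z] with w hw
      change m (ofComplex w : ℍ) i j = _
      rw [ofComplex_apply_of_im_pos hw]
    suffices h : ∃ a b, HasWirtingerAt (fun w => m w i j) a b z ∧
        ∀ v, a * v + b * starRingEnd ℂ v = (m z * fuchsianForm z v) i j by
      obtain ⟨a, b, h1, h2⟩ := h
      have h3 := h1.congr hev
      exact ⟨h3.differentiableAt, fun v => by rw [h3.fderiv_apply, h2]; rfl⟩
    have hid := (hasDerivAt_id (z : ℂ)).hasWirtingerAt
    have hk := (HasWirtingerAt.const (w := (z : ℂ)) (Complex.I / 2)).mul (hasWirtingerAt_inv_im z)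
    have hr := HasWirtingerAt.const (w := (z : ℂ)) ((√2 : ℝ) : ℂ)
    have h1 := HasWirtingerAt.const (w := (z : ℂ)) 1
    have hI := Complex.I_sq
    fin_cases i <;> fin_cases j
    · refine ⟨_, _, hid, fun v => ?_⟩
      rw [fuchsianForm_eq]
      simp [hm, Matrix.mul_apply, Fin.sum_univ_two]
      field_simp
      ring
    · refine ⟨_, _, hr.mul (h1.add (hk.mul hid)), fun v => ?_⟩
      rw [fuchsianForm_eq]
      simp [hm, Matrix.mul_apply, Fin.sum_univ_two]
      field_simp
      ring_nf
      simp only [hs2, hI]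
      ring
    · refine ⟨_, _, h1, fun v => ?_⟩
      rw [fuchsianForm_eq]
      simp [hm, Matrix.mul_apply, Fin.sum_univ_two]
      field_simp
      ring
    · refine ⟨_, _, hr.mul hk, fun v => ?_⟩
      rw [fuchsianForm_eq]
      simp [hm, Matrix.mul_apply, Fin.sum_univ_two]
      field_simp
      simp only [hs2, hI]
      ring
  · obtain ⟨_, h⟩ := mk_smul_basePoint (M z) (v := ![(z : ℂ), 1]) fun i => by
      change _ = m z i 0
      fin_cases i <;> simp [hm]
    exact h

end EP

/-! ### Osculating maps and Epstein surfaces -/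

open EP in
theorem proposition4p3 (ρ : EP.ConformalMetric) (Dev₁ Dev₂ : UpperHalfPlane → EP.ProjLine)
    (hol₁ : EP.Holomorphic Dev₁) (inj₁ : EP.LocallyInjective Dev₁)
    (hol₂ : EP.Holomorphic Dev₂) (inj₂ : EP.LocallyInjective Dev₂) :
    -- the osculating map and the two Epstein surfaces exist and are unique
    (∃! Osc : UpperHalfPlane → PGL(2, ℂ), ∀ z, EP.Osculates (Osc z) Dev₂ Dev₁ z) ∧
    (∃! E₁ : UpperHalfPlane → EP.HypThree, EP.IsEpsteinSurface ρ Dev₁ E₁) ∧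
    (∃! E₂ : UpperHalfPlane → EP.HypThree, EP.IsEpsteinSurface ρ Dev₂ E₂) ∧
    -- the osculating map carries one Epstein surface to the other
    (∀ (Osc : UpperHalfPlane → PGL(2, ℂ)) (E₁ E₂ : UpperHalfPlane → EP.HypThree),
      (∀ z, EP.Osculates (Osc z) Dev₂ Dev₁ z) →
      EP.IsEpsteinSurface ρ Dev₁ E₁ → EP.IsEpsteinSurface ρ Dev₂ E₂ →
      ∀ z, Osc z • E₂ z = E₁ z) ∧
    -- the Epstein-Poincaré surface of an oper is the classical surface of the hyperbolic metric
    (∀ S : UpperHalfPlane → EP.HypThree,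
      EP.IsEPSurface Dev₁ S ↔ EP.IsEpsteinSurface EP.hyperbolicMetric Dev₁ S) := by
  have lift₁ := exists_isUnimodularLift hol₁ inj₁
  have lift₂ := exists_isUnimodularLift hol₂ inj₂
  choose N₁ hN₁ using fun z => (lift₁ z).choose_spec.exists_isFrame
  choose N₂ hN₂ using fun z => (lift₂ z).choose_spec.exists_isFrame
  have hosc : ∀ (z : ℍ) (g : PGL(2, ℂ)), Osculates g Dev₂ Dev₁ z ↔
      g = Matrix.ProjGenLinGroup.mk (N₁ z) * (Matrix.ProjGenLinGroup.mk (N₂ z))⁻¹ := by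
    intro z g
    obtain ⟨N', hN', h⟩ := (hN₂ z).exists_smul g
    rw [Osculates, hN'.twoJetEq_iff (hN₁ z), h, eq_mul_inv_iff_mul_eq]
  refine ⟨⟨fun z => Matrix.ProjGenLinGroup.mk (N₁ z) * (Matrix.ProjGenLinGroup.mk (N₂ z))⁻¹,
      fun z => (hosc z _).mpr rfl, fun O hO => funext fun z => (hosc z _).mp (hO z)⟩,
    ⟨fun z => N₁ z • normalizedPoint ρ z, (isEpsteinSurface_iff lift₁ hN₁).mpr fun _ => rfl,
      fun E hE => funext ((isEpsteinSurface_iff lift₁ hN₁).mp hE)⟩,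
    ⟨fun z => N₂ z • normalizedPoint ρ z, (isEpsteinSurface_iff lift₂ hN₂).mpr fun _ => rfl,
      fun E hE => funext ((isEpsteinSurface_iff lift₂ hN₂).mp hE)⟩, ?_, ?_⟩
  · intro O E₁ E₂ hO hE₁ hE₂ z
    rw [(isEpsteinSurface_iff lift₁ hN₁).mp hE₁, (isEpsteinSurface_iff lift₂ hN₂).mp hE₂,
      (hosc z _).mp (hO z), ← mk_smul_hypThree (N₂ z), smul_smul, inv_mul_cancel_right,
      mk_smul_hypThree]
  · intro S
    have hfr : ∀ z, ∃ N, IsFrame fuchsianDev z N := fun z => by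
      obtain ⟨P, hP⟩ := exists_isUnimodularLift_fuchsianDev z
      exact hP.exists_isFrame
    choose N hN using hfr
    have key : ∀ (L₂ L₁ : ℍ → PGL(2, ℂ)) (S₀ : ℍ → HypThree), IsCanonicalLift fuchsianDev L₂ →
        IsCanonicalLift Dev₁ L₁ → IsFuchsianSurface S₀ → ∀ z,
        (L₁ z * (L₂ z)⁻¹) • S₀ z = N₁ z • normalizedPoint hyperbolicMetric z := by
      intro L₂ L₁ S₀ h₂ h₁ h₀ z
      rw [h₂.eq_mk (hN z), h₁.eq_mk (hN₁ z), h₀.eq_smul (hN z), ← mk_smul_hypThree (N z), smul_smul,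
        ← mk_smul_hypThree (N₁ z)]
      congr 1
      group
    rw [isEpsteinSurface_iff lift₁ hN₁]
    constructor
    · rintro ⟨O, S₀, ⟨L₂, L₁, h₂, h₁, hO⟩, h₀, hS⟩ z
      rw [hS, hO, key L₂ L₁ S₀ h₂ h₁ h₀]
    · intro hS
      obtain ⟨L₂, h₂⟩ := exists_isCanonicalLift exists_isUnimodularLift_fuchsianDev
      obtain ⟨L₁, h₁⟩ := exists_isCanonicalLift lift₁
      obtain ⟨S₀, h₀⟩ := exists_isFuchsianSurface
      exact ⟨fun z => L₁ z * (L₂ z)⁻¹, S₀, ⟨L₂, L₁, h₂, h₁, fun _ => rfl⟩, h₀, fun z => by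
        rw [hS, key L₂ L₁ S₀ h₂ h₁ h₀]⟩
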